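/- **Setting.** Let $M$ be a smooth connected manifold of dimension $d$, and let $X^{01},\dots,X^{0N_0}$ be smooth vector fields on $M$. Put $\mathcal D_0=\mathrm{span}\{X^{01},\dots,X^{0N_0}\}$, $\mathcal D_{i+1}=\mathcal D_i+[\mathcal D_0,\mathcal D_i]$, $n_i(m)=\dim\mathcal D_i(m)$ for $i\ge 0$, and $n_{-1}=0$. Assume Hörmander's condition: for every $m\in M$ there is a smallest integer $r(m)$ with $\mathcal D_{r(m)}(m)=T_mM$; assume moreover that $\boldsymbol r=\max_M r(m)$ exists. A point $m$ is *equiregular* if $(n_0,\dots,n_{\boldsymbol r})$ is constant near $m$; these points form the equiregular region. Let $$Q(m)=\sum_{i=0}^{\boldsymbol r}(i+1)\,\bigl(n_i(m)-n_{i-1}(m)\bigr),$$ and assume that $Q(m)$ takes the same value $\boldsymbol Q$ at all equiregular points. **Approximating metrics.** For a multi-index $I=(i_1,\dots,i_{k+1})\in\{1,\dots,N_0\}^{k+1}$ let $X_I=[X^{0i_1},[X^{0i_2},\dots,[X^{0i_k},X^{0i_{k+1}}]\dots]]$. Let $X^{k1},\dots,X^{kN_k}$ be an enumeration of those $X_I$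 with $I$ of length $k+1$ that do not vanish identically (for $k=0$, of all the given fields), indexed by the multi-indices $I$. For $h>0$, $m\in M$ and $v\in T_mM$ put $$g^h_m(v)=\inf\Bigl\{\sum_{i=0}^{\boldsymbol r}\sum_{j=1}^{N_i}h^{-2i}u_{ij}^2\;:\;u_{ij}\in\mathbb R,\ \sum_{i=0}^{\boldsymbol r}\sum_{j=1}^{N_i}u_{ij}X^{ij}_m=v\Bigr\}.$$ Let $\mathrm{dvol}_{g^h}$ be the Riemannian density of $g^h$. It equals $\sqrt{|\det (g^h(Z_i,Z_j))|}\,|\nu_1\wedge\dots\wedge\nu_d|$ in a frame $Z$ with dual frame $\nu$. **Popp's volume.** Let $g^0_m(v)=\inf\{\sum_i u_i^2:\sum_i u_iX^{0i}_m=v\}$, with $\inf\emptyset=+\infty$. A smooth local frame $Z_1,\dots,Z_d$ is *adapted* at $m$ if, near $m$, $Z_1,\dots,Z_{n_i(m)}$ span $\mathcal D_i$ for $0\le i\le\boldsymbol r$, and $Z_1(m),\dots,Z_{n_0(m)}(m)$ are orthonormal for $g^0_m$. Let $\nu$ be the dual frame. For $n_{j-1}<k,l\le n_j$ let $$[B_j]^{kl}=\sum_{i_1,\dots,i_{j+1}=1}^{n_0}b^k_{i_1\dots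 i_{j+1}}b^l_{i_1\dots i_{j+1}},$$ where $b^l_{i_1\dots i_{j+1}}$ is the coefficient of $Z_l$ in $[Z_{i_1},[Z_{i_2},\dots,Z_{i_{j+1}}]\dots]$ at $m$ (so $B_0$ is the identity). Popp's volume at $m$ is the density $$\mathcal P=\Bigl(\prod_{j=0}^{\boldsymbol r}\det B_j\Bigr)^{-1/2}|\nu_1\wedge\dots\wedge\nu_d|.$$ **Theorem.** At every equiregular point an adapted frame exists, and $\mathcal P$ does not depend on the choice of this frame. As $h\to0^+$, $h^{\boldsymbol Q-d}\,\mathrm{dvol}_{g^h}$ converges to $\mathcal P$ uniformly on compact subsets of the equiregular region. That is, the quotient $h^{\boldsymbol Q-d}\,\mathrm{dvol}_{g^h}/\mathcal P$ converges to $1$ uniformly on each such compact set; and, for every smooth local frame $V$ on an open set $U$, $h^{\boldsymbol Q-d}\,\mathrm{dvol}_{g^h}(V_1,\dots,V_d)$ converges to $\mathcal P(V_1,\dots,V_d)$ uniformly on each compact subset of $U$ contained in the equiregular region. Moreover, with $f_h=(\mathrm{dvol}_{g^1}/\mathrm{dvol}_{g^h})^2$, the limit $f=\lim_{h\to0^+}h^{2(d-\boldsymbol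 Q)}f_h$ exists and is positive at every equiregular point, and the volume $\mathcal P_o=f^{-1/2}\,\mathrm{dvol}_{g^1}$ induced by the approximation scheme equals $\mathcal P$ on the equiregular region. -/

import Mathlib

open scoped Manifold ContDiff Topology ENNReal
open Filter

namespace SubRiem

noncomputable section

/-- Vector fields on a manifold modelled on `ℝ^d`. -/
abbrev VField (d : ℕ) (M : Type*) [TopologicalSpace M]
    [ChartedSpace (EuclideanSpace ℝ (Fin d)) M] : Type _ :=
  (m : M) → TangentSpace (𝓡 d) m

section Defs

variable {d : ℕ} {M : Type*} [TopologicalSpace M] [ChartedSpace (EuclideanSpace ℝ (Fin d)) M]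

/-- The iterated bracket `[X_{I 0}, [X_{I 1}, [ … [X_{I (k-1)}, X_{I k}] … ]]]` of the `k + 1`
fields labelled by `I`. -/
def iterBracket {ι : Type*} (X : ι → VField d M) : (k : ℕ) → (Fin (k + 1) → ι) → VField d M
  | 0, I => X (I 0)
  | k + 1, I => VectorField.mlieBracket (𝓡 d) (X (I 0)) (iterBracket X k (Fin.tail I))

variable {N₀ : ℕ} (X : Fin N₀ → VField d M)

/-- The spaces of vector fields `𝒟₀ = span {X₁, …, X_{N₀}}`, `𝒟_{i+1} = 𝒟_i + [𝒟₀, 𝒟_i]`. -/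
def flag : ℕ → Submodule ℝ (VField d M)
  | 0 => Submodule.span ℝ (Set.range X)
  | i + 1 => flag i ⊔ Submodule.span ℝ
      {W | ∃ U ∈ Submodule.span ℝ (Set.range X), ∃ V ∈ flag i,
        W = VectorField.mlieBracket (𝓡 d) U V}

/-- The subspace `𝒟_i(m)` of `T_m M`. -/
def flagAt (i : ℕ) (m : M) : Submodule ℝ (TangentSpace (𝓡 d) m) :=
  (flag X i).map (LinearMap.proj m)

/-- The growth vector `n_i(m) = dim 𝒟_i(m)`. -/
def growth (i : ℕ) (m : M) : ℕ := Module.finrank ℝ (flagAt X i m)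

/-- `n_{i-1}(m)`, with the convention `n_{-1}(m) = 0`. -/
def prevGrowth : ℕ → M → ℕ
  | 0, _ => 0
  | i + 1, m => growth X i m

/-- Hörmander's bracket condition at every point. -/
def Hormander : Prop := ∀ m : M, ∃ i, flagAt X i m = ⊤

/-- `r(m)`, the smallest integer with `𝒟_{r(m)}(m) = T_m M`. -/
def stepAt (m : M) : ℕ := sInf {i | flagAt X i m = ⊤}

variable (r : ℕ)

/-- The equiregular region: points near which the growth vector `(n_0, …, n_r)` is constant. -/
def equiregularRegion : Set M :=
  {m | ∀ᶠ p in 𝓝 m, ∀ i ≤ r, growth X i p = growth X i m}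

/-- `Q(m) = ∑_{i=0}^{r} (i + 1) (n_i(m) - n_{i-1}(m))`. -/
def homDim (m : M) : ℤ :=
  ∑ i ∈ Finset.range (r + 1), ((i : ℤ) + 1) * ((growth X i m : ℤ) - (prevGrowth X i m : ℤ))

/-- The sub-Riemannian metric `g⁰`, equal to `∞` outside `𝒟₀`. -/
def subRiemMetric (m : M) (v : TangentSpace (𝓡 d) m) : ℝ≥0∞ :=
  ⨅ (u : Fin N₀ → ℝ) (_ : ∑ i, u i • X i m = v), ENNReal.ofReal (∑ i, u i ^ 2)

/-- The scalar product on `𝒟₀(m)` obtained from `g⁰` by polarization. -/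
def subRiemInner (m : M) (v w : TangentSpace (𝓡 d) m) : ℝ :=
  ((subRiemMetric X m (v + w)).toReal - (subRiemMetric X m v).toReal
    - (subRiemMetric X m w).toReal) / 2

/-- The brackets used at level `i`: all the given fields for `i = 0`, and, for `i ≥ 1`, the
multi-indices of length `i + 1` whose bracket does not vanish identically. -/
def IsBracketIndex (i : ℕ) (I : Fin (i + 1) → Fin N₀) : Prop :=
  i = 0 ∨ ∃ m, iterBracket X i I m ≠ 0

/-- The pairs `(i, j)`, `0 ≤ i ≤ r`, `1 ≤ j ≤ N_i`: a level `i` and a bracket at level `i`. -/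
abbrev BracketIndex : Type :=
  (i : Fin (r + 1)) × {I : Fin ((i : ℕ) + 1) → Fin N₀ // IsBracketIndex X i I}

instance : Fintype (BracketIndex X r) := Fintype.ofFinite _

/-- The map `σ_m : ℝ^N → T_m M`. -/
def sigmaMap (m : M) (u : BracketIndex X r → ℝ) : TangentSpace (𝓡 d) m :=
  ∑ a, u a • iterBracket X a.1 a.2.1 m

/-- The anisotropic dilation `δ_h` of `ℝ^N`. -/
def dilation (h : ℝ) (u : BracketIndex X r → ℝ) : BracketIndex X r → ℝ :=
  fun a => (h ^ (a.1 : ℕ))⁻¹ * u a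

/-- The quadratic form `g^h_m(v) = inf { |δ_h u|² : σ_m(u) = v }`. -/
def approxMetric (h : ℝ) (m : M) (v : TangentSpace (𝓡 d) m) : ℝ :=
  sInf {q | ∃ u : BracketIndex X r → ℝ, sigmaMap X r m u = v ∧ q = ∑ a, dilation X r h u a ^ 2}

/-- The scalar product of `g^h_m`, by polarization. -/
def approxInner (h : ℝ) (m : M) (v w : TangentSpace (𝓡 d) m) : ℝ :=
  (approxMetric X r h m (v + w) - approxMetric X r h m v - approxMetric X r h m w) / 2

/-- The Riemannian density `dvol_{g^h}`, evaluated on `d` tangent vectors: the square root of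
the absolute value of their Gram determinant. If `Z` is a frame with dual frame `ν`, this is
`√|det (g^h(Z_i, Z_j))| |ν_1 ∧ … ∧ ν_d|`. -/
def approxVol (h : ℝ) (m : M) (v : Fin d → TangentSpace (𝓡 d) m) : ℝ :=
  √|(Matrix.of fun i j => approxInner X r h m (v i) (v j)).det|

variable [IsManifold (𝓡 d) ∞ M]

/-- A local frame `Z_1, …, Z_d` that is adapted at `m`: near `m`, the first `n_i(m)` fields
span `𝒟_i` for `0 ≤ i ≤ r`, and the first `n_0(m)` fields are orthonormal at `m`. -/
structure AdaptedFrame (m : M) where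
  /-- The domain of the frame. -/
  dom : Set M
  isOpen_dom : IsOpen dom
  mem_dom : m ∈ dom
  /-- The fields of the frame. -/
  Z : Fin d → VField d M
  isFrame : IsLocalFrameOn (𝓡 d) (EuclideanSpace ℝ (Fin d)) ∞ Z dom
  span_eq : ∀ p ∈ dom, ∀ i ≤ r,
    Submodule.span ℝ ((fun k => Z k p) '' {k : Fin d | (k : ℕ) < growth X i m}) = flagAt X i p
  orthonormal : ∀ k l : Fin d, (k : ℕ) < growth X 0 m → (l : ℕ) < growth X 0 m →
    subRiemInner X m (Z k m) (Z l m) = if k = l then 1 else 0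

namespace AdaptedFrame

variable {X r} {m : M}

/-- The basis `Z_1(m), …, Z_d(m)` of `T_m M`. -/
def basis (F : AdaptedFrame X r m) : Module.Basis (Fin d) ℝ (TangentSpace (𝓡 d) m) :=
  F.isFrame.toBasisAt F.mem_dom

/-- The adapted structure constant `b^l_{i_1 … i_{j+1}}` at `m`: the coefficient of `Z_l(m)` in
`[Z_{i_1}, [ … , Z_{i_{j+1}}] … ](m)`, where `i_1, …, i_{j+1} ≤ n_0`. -/
def structConst (F : AdaptedFrame X r m) (j : ℕ)
    (I : Fin (j + 1) → {k : Fin d // (k : ℕ) < growth X 0 m}) (l : Fin d) : ℝ :=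
  F.basis.repr (iterBracket F.Z j (fun a => (I a).1) m) l

/-- The matrix `B_j`, indexed by the `l` with `n_{j-1} < l ≤ n_j` (shifted by one, since
`Fin d` starts at zero). For `j = 0` this is the identity matrix. -/
def B (F : AdaptedFrame X r m) (j : ℕ) :
    Matrix {l : Fin d // prevGrowth X j m ≤ (l : ℕ) ∧ (l : ℕ) < growth X j m}
      {l : Fin d // prevGrowth X j m ≤ (l : ℕ) ∧ (l : ℕ) < growth X j m} ℝ :=
  Matrix.of fun k l => ∑ I, F.structConst j I k.1 * F.structConst j I l.1

/-- The density `(∏_j det B_j)^{-1/2} |ν_1 ∧ … ∧ ν_d|` at `m`, where `ν` is the dual frame. -/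
def poppFormula (F : AdaptedFrame X r m) (v : Fin d → TangentSpace (𝓡 d) m) : ℝ :=
  (√(∏ j ∈ Finset.range (r + 1), (F.B j).det))⁻¹ * |F.basis.det v|

end AdaptedFrame

open Classical in
/-- Popp's volume, as a density: its expression in a frame adapted at the point. (It is set to
zero at points that have no adapted frame, that is at singular points.) -/
def poppVol (m : M) (v : Fin d → TangentSpace (𝓡 d) m) : ℝ :=
  if hF : Nonempty (AdaptedFrame X r m) then hF.some.poppFormula v else 0

/-- A basis of `T_m M`, used to form quotients of densities. -/
def refBasis (m : M) : Fin d → TangentSpace (𝓡 d) m :=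
  fun i => (EuclideanSpace.single i 1 : EuclideanSpace ℝ (Fin d))

/-- `f_h = (dvol_{g^1} / dvol_{g^h})²`. -/
def volRatioSq (h : ℝ) (m : M) : ℝ :=
  (approxVol X r 1 m (refBasis m) / approxVol X r h m (refBasis m)) ^ 2

/-- `f = lim_{h → 0} h^{2 (d - Q)} f_h`. -/
def limRatio (Q : ℤ) (m : M) : ℝ :=
  limUnder (𝓝[>] (0 : ℝ)) (fun h : ℝ => h ^ (2 * ((d : ℤ) - Q)) * volRatioSq X r h m)

/-- The volume `𝒫_o = f^{-1/2} dvol_{g^1}` induced by the approximation scheme. -/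
def inducedVol (Q : ℤ) (m : M) (v : Fin d → TangentSpace (𝓡 d) m) : ℝ :=
  (√(limRatio X r Q m))⁻¹ * approxVol X r 1 m v

end Defs

end

end SubRiem

/-! Fix an equiregular point and a basis of the tangent space adapted to the flag, and give the k-th
basis vector the weight `w k`, the first level of the flag that contains it. A bracket of level i
lies in 𝒟_i, so it has no coordinate of weight greater than i. Dilate the source ℝ^N by h^{-level}
and the tangent space by h^{-weight}. The matrix of the map σ then has entries h^{level - weight}
times the old ones, with no negative powers of h: it is a matrix `A h` that is polynomial in h, and
the quotient metric is given by the inverse of its Gram matrix `A h * (A h)ᵀ`. The dilation of the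
tangent space contributes h^{-∑ w} to the volume, and ∑ w = Q - d. Hence h^{Q-d} dvol is |det| /
√det(A Aᵀ) exactly, for every h > 0 (`approxVol_eq`), and it has a finite limit because the Gram
determinant stays positive at h = 0 (`IsAdaptedBasis.det_pos`).

At h = 0 only the entries with level = weight survive, so the Gram matrix is block diagonal, with
one block per level. Its j-th block is B_j: modulo 𝒟_{j-1}, an iterated bracket is multilinear in
the values of its entries at the point (`FlagFrame.iterBracket_sub_mem`), which rewrites the
brackets of the given fields through the structure constants of the frame; orthonormality of the
first n_0 frame vectors then makes the sum over the given fields collapse to a sum over the frame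
(`AdaptedFrame.sum_repr_mul_repr`).

The limit is computed in an arbitrary adapted frame, while the rescaled volume involves no frame.
Uniqueness of limits therefore shows that Popp's volume is independent of the frame. For uniformity,
a frame made of fields in the flag serves a whole neighbourhood, and in it the Gram determinant is
jointly continuous at (0, m) (`exists_local_formula`). -/

namespace SubRiem

/-! ### Linear algebra: quotient norms, rescaled Gram matrices, orthonormality -/

section LinearAlgebra

open Matrix

/-- The minimal squared Euclidean norm on a fibre of a surjective matrix. -/
theorem isLeast_sum_sq {m n : Type*} [Fintype m] [Fintype n] [DecidableEq m]
    (A : Matrix m n ℝ) (hA : IsUnit (A * Aᵀ).det) (y : m → ℝ) :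
    IsLeast {q | ∃ u, A *ᵥ u = y ∧ q = ∑ a, u a ^ 2} (y ⬝ᵥ ((A * Aᵀ)⁻¹ *ᵥ y)) := by
  set z := (A * Aᵀ)⁻¹ *ᵥ y with hz
  have hAz : A *ᵥ (Aᵀ *ᵥ z) = y := by
    rw [mulVec_mulVec, hz, mulVec_mulVec, mul_nonsing_inv _ hA, one_mulVec]
  have key : ∀ u, A *ᵥ u = y → u ⬝ᵥ (Aᵀ *ᵥ z) = y ⬝ᵥ z := by
    intro u hu
    rw [dotProduct_mulVec, vecMul_transpose, hu]
  refine ⟨⟨Aᵀ *ᵥ z, hAz, ?_⟩, ?_⟩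
  · rw [← key _ hAz]; simp [dotProduct, sq]
  · rintro q ⟨u, hu, rfl⟩
    -- Pythagoras: `Aᵀ *ᵥ z` lies in the fibre and is orthogonal to the kernel of `A`, so it is the
    -- shortest point.
    have h1 : 0 ≤ ∑ a, (u a - (Aᵀ *ᵥ z) a) ^ 2 := by positivity
    have h2 : ∑ a, (u a - (Aᵀ *ᵥ z) a) ^ 2 = ∑ a, u a ^ 2 - 2 * (u ⬝ᵥ (Aᵀ *ᵥ z))
        + (Aᵀ *ᵥ z) ⬝ᵥ (Aᵀ *ᵥ z) := by
      simp only [dotProduct, Finset.mul_sum, ← Finset.sum_sub_distrib, ← Finset.sum_add_distrib]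
      exact Finset.sum_congr rfl fun a _ => by ring
    rw [h2, key u hu, key _ hAz] at h1
    linarith

theorem det_mul_transpose_pos {m n : Type*} [Fintype m] [Fintype n] [DecidableEq m]
    (A : Matrix m n ℝ) (hA : ∀ y, y ᵥ* A = 0 → y = 0) : 0 < (A * Aᵀ).det := by
  refine PosDef.det_pos ?_
  have := PosDef.mul_conjTranspose_self A (fun y z hyz => by
    have := hA (y - z) (by rw [sub_vecMul]; exact sub_eq_zero.2 hyz)
    exact sub_eq_zero.1 this)
  simpa using this

/-- Polarization of a quadratic form given by a symmetric matrix. -/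
theorem polarization {m : Type*} [Fintype m] (S : Matrix m m ℝ) (hS : Sᵀ = S) (y z : m → ℝ) :
    ((y + z) ⬝ᵥ (S *ᵥ (y + z)) - y ⬝ᵥ (S *ᵥ y) - z ⬝ᵥ (S *ᵥ z)) / 2 = y ⬝ᵥ (S *ᵥ z) := by
  have : z ⬝ᵥ (S *ᵥ y) = y ⬝ᵥ (S *ᵥ z) := by
    rw [dotProduct_mulVec, ← mulVec_transpose, hS, dotProduct_comm]
  simp only [mulVec_add, add_dotProduct, dotProduct_add, this]
  ring

theorem transpose_inv_mul_transpose {m n : Type*} [Fintype m] [Fintype n] [DecidableEq m]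
    (A : Matrix m n ℝ) : ((A * Aᵀ)⁻¹)ᵀ = (A * Aᵀ)⁻¹ := by
  rw [transpose_nonsing_inv, transpose_mul, transpose_transpose]

variable {E : Type*} [AddCommGroup E] [Module ℝ E] {d : ℕ} {α : Type*}

/-- The coordinates of the vectors `x a`, of level `lev a`, in a basis with weights `w`, rescaled
by the anisotropic dilations of the source and of the target. -/
noncomputable def scaledCoord (b : Module.Basis (Fin d) ℝ E) (w : Fin d → ℕ) (x : α → E)
    (lev : α → ℕ) (h : ℝ) : Matrix (Fin d) α ℝ :=
  of fun k a => h ^ (lev a - w k) * b.repr (x a) k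

/-- The basis `b` with weights `w` is adapted to the filtration generated by the vectors `x a` of
level `lev a`. -/
def IsAdaptedBasis (b : Module.Basis (Fin d) ℝ E) (w : Fin d → ℕ) (x : α → E)
    (lev : α → ℕ) : Prop :=
  ∀ j, Submodule.span ℝ (b '' {k | w k ≤ j}) = Submodule.span ℝ (x '' {a | lev a ≤ j})

variable {b : Module.Basis (Fin d) ℝ E} {w : Fin d → ℕ} {x : α → E} {lev : α → ℕ}

theorem repr_eq_zero_of_mem_span {s : Set (Fin d)} {v : E}
    (hv : v ∈ Submodule.span ℝ (b '' s)) {k : Fin d} (hk : k ∉ s) : b.repr v k = 0 := by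
  by_contra h
  exact hk ((b.mem_span_image.1 hv) (by simpa using h))

theorem IsAdaptedBasis.repr_eq_zero (hb : IsAdaptedBasis b w x lev) {a : α} {k : Fin d}
    (h : lev a < w k) : b.repr (x a) k = 0 := by
  refine repr_eq_zero_of_mem_span (s := {k | w k ≤ lev a}) ?_ (by simpa using h)
  rw [hb]
  exact Submodule.subset_span ⟨a, le_refl (lev a), rfl⟩

variable [Fintype α]

/-- The rows of the rescaled matrix are independent for every h, including h = 0, because its
diagonal part (level = weight) does not involve h and already has full rank. A relation `y` among
the rows is shown to vanish weight by weight: its part of weight j defines a functional that kills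
all vectors of level at most j, hence also the basis vectors of weight j. -/
theorem IsAdaptedBasis.det_pos (hb : IsAdaptedBasis b w x lev) (h : ℝ) :
    0 < (scaledCoord b w x lev h * (scaledCoord b w x lev h)ᵀ).det := by
  classical
  refine det_mul_transpose_pos _ fun y hy => ?_
  have main : ∀ j k, w k = j → y k = 0 := by
    intro j
    induction j using Nat.strong_induction_on with
    | _ j ih =>
      let φ : E →ₗ[ℝ] ℝ := ∑ k, (if w k = j then y k else 0) • b.coord k
      have hφ : ∀ v, φ v = ∑ k, (if w k = j then y k else 0) * b.repr v k := fun v => by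
        simp only [φ, LinearMap.sum_apply, LinearMap.smul_apply, smul_eq_mul,
          Module.Basis.coord_apply]
      have hker : Submodule.span ℝ (x '' {a | lev a ≤ j}) ≤ LinearMap.ker φ := by
        rw [Submodule.span_le]
        rintro _ ⟨a, ha, rfl⟩
        simp only [SetLike.mem_coe, LinearMap.mem_ker, hφ]
        rcases lt_or_eq_of_le (show lev a ≤ j from ha) with ha | ha
        · refine Finset.sum_eq_zero fun k _ => ?_
          split_ifs with hk
          · rw [hb.repr_eq_zero (hk ▸ ha), mul_zero]
          · rw [zero_mul]
        -- In the column of a vector of level exactly j, weights below j drop out by induction,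
        -- weights above j because the coordinate is zero, and weight j carries the factor h^0 = 1.
        · have h0 := congrFun hy a
          simp only [vecMul, dotProduct, scaledCoord, of_apply, Pi.zero_apply] at h0
          refine Eq.trans (Finset.sum_congr rfl fun k _ => ?_) h0
          rcases lt_trichotomy (w k) j with hk | hk | hk
          · rw [if_neg hk.ne, ih _ hk k rfl, zero_mul, zero_mul]
          · rw [if_pos hk, hk, ha]; simp
          · rw [if_neg hk.ne', hb.repr_eq_zero (ha.trans_lt hk)]; simp
      intro k hk
      have : b k ∈ LinearMap.ker φ := hker (by
        rw [← hb]; exact Submodule.subset_span ⟨k, hk.le, rfl⟩)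
      rw [LinearMap.mem_ker, hφ, Finset.sum_eq_single k] at this
      · simpa [hk] using this
      · intro l _ hl; simp [hl.symm]
      · simp
  exact funext fun k => main _ k rfl

/-- The quotient metric of the dilated Euclidean metric. -/
theorem IsAdaptedBasis.isLeast (hb : IsAdaptedBasis b w x lev) {h : ℝ} (hh : h ≠ 0) (v : E) :
    IsLeast {q | ∃ u : α → ℝ, ∑ a, u a • x a = v ∧ q = ∑ a, ((h ^ lev a)⁻¹ * u a) ^ 2}
      ((fun k => (h ^ w k)⁻¹ * b.repr v k) ⬝ᵥ
        ((scaledCoord b w x lev h * (scaledCoord b w x lev h)ᵀ)⁻¹ *ᵥ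
          fun k => (h ^ w k)⁻¹ * b.repr v k)) := by
  have := isLeast_sum_sq (scaledCoord b w x lev h) (hb.det_pos h).ne'.isUnit
    (fun k => (h ^ w k)⁻¹ * b.repr v k)
  convert this using 1
  have key : ∀ u : α → ℝ, ∑ a, u a • x a = v ↔
      scaledCoord b w x lev h *ᵥ (fun a => (h ^ lev a)⁻¹ * u a) =
        fun k => (h ^ w k)⁻¹ * b.repr v k := by
    intro u
    rw [← b.repr.injective.eq_iff, DFunLike.ext_iff, funext_iff]
    refine forall_congr' fun k => ?_
    have h1 : (scaledCoord b w x lev h *ᵥ (fun a => (h ^ lev a)⁻¹ * u a)) k =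
        (h ^ w k)⁻¹ * b.repr (∑ a, u a • x a) k := by
      simp only [mulVec, dotProduct, scaledCoord, of_apply, map_sum, map_smul,
        Finsupp.coe_finsetSum, Finset.sum_apply, Finsupp.smul_apply, smul_eq_mul, Finset.mul_sum]
      refine Finset.sum_congr rfl fun a _ => ?_
      -- The exponent `lev a - w k` is truncated to 0 when the level is below the weight; this does
      -- no harm, since the coordinate vanishes there.
      rcases lt_or_ge (lev a) (w k) with hlt | hge
      · rw [hb.repr_eq_zero hlt]; simp
      · have : h ^ lev a = h ^ (lev a - w k) * h ^ w k := by
          rw [← pow_add, Nat.sub_add_cancel hge]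
        rw [this]
        field_simp
    rw [h1, mul_right_inj' (inv_ne_zero (pow_ne_zero _ hh))]
  ext q
  constructor
  · rintro ⟨u, hu, rfl⟩
    exact ⟨_, (key u).1 hu, rfl⟩
  · rintro ⟨u, hu, rfl⟩
    have hu' : u = fun a => (h ^ lev a)⁻¹ * (h ^ lev a * u a) := funext fun a => by
      rw [inv_mul_cancel_left₀ (pow_ne_zero _ hh)]
    refine ⟨fun a => h ^ lev a * u a, (key _).2 (by rw [← hu']; exact hu), ?_⟩
    exact Finset.sum_congr rfl fun a _ => by rw [inv_mul_cancel_left₀ (pow_ne_zero _ hh)]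

/-- Since 0^0 = 1 and all other powers of 0 vanish, h = 0 keeps only the entries whose level equals
the weight. A column therefore meets rows of a single weight, which gives the block structure. -/
theorem scaledCoord_zero_gram_apply (hb : IsAdaptedBasis b w x lev) (k l : Fin d) :
    (scaledCoord b w x lev 0 * (scaledCoord b w x lev 0)ᵀ) k l =
      if w k = w l then ∑ a with lev a = w k, b.repr (x a) k * b.repr (x a) l else 0 := by
  have h0 : ∀ a k, scaledCoord b w x lev 0 k a = if lev a = w k then b.repr (x a) k else 0 := by
    intro a k
    simp only [scaledCoord, of_apply]
    rcases lt_trichotomy (lev a) (w k) with h | h | h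
    · rw [if_neg h.ne, hb.repr_eq_zero h, mul_zero]
    · rw [if_pos h, h]; simp
    · rw [if_neg h.ne', zero_pow (by omega), zero_mul]
  simp only [mul_apply, transpose_apply, h0]
  split_ifs with hkl
  · rw [Finset.sum_filter]
    refine Finset.sum_congr rfl fun a _ => ?_
    rw [← hkl]; split_ifs <;> simp
  · refine Finset.sum_eq_zero fun a _ => ?_
    split_ifs with h1 h2 <;> simp
    exact absurd (h1.symm.trans h2) hkl

/-- The determinant of a block diagonal matrix. -/
theorem det_eq_prod_blocks {n : Type*} [Fintype n] [DecidableEq n] (S : Matrix n n ℝ)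
    (w : n → ℕ) (r : ℕ) (hw : ∀ k, w k ≤ r) (hS : ∀ k l, w k ≠ w l → S k l = 0) :
    S.det = ∏ j ∈ Finset.range (r + 1), (S.toSquareBlock w j).det := by
  rw [BlockTriangular.det (b := w) (fun k l hkl => hS _ _ hkl.ne')]
  refine Finset.prod_subset (fun j hj => ?_) fun j _ hj => ?_
  · obtain ⟨k, -, rfl⟩ := Finset.mem_image.1 hj
    exact Finset.mem_range.2 (Nat.lt_succ_of_le (hw k))
  · have : IsEmpty {a // w a = j} :=
      ⟨fun a => hj (Finset.mem_image.2 ⟨a.1, Finset.mem_univ _, a.2⟩)⟩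
    exact det_isEmpty

/-- The determinant of the Gram matrix of a family of vectors for a pulled back scalar product. -/
theorem sqrt_abs_det_gram {S : Matrix (Fin d) (Fin d) ℝ} (hS : 0 < S.det)
    (b : Module.Basis (Fin d) ℝ E) (c : Fin d → ℝ) (v : Fin d → E) :
    √|(of fun i j => (fun k => c k * b.repr (v i) k) ⬝ᵥ
        (S⁻¹ *ᵥ fun k => c k * b.repr (v j) k)).det| = |∏ k, c k| * |b.det v| * (√S.det)⁻¹ := by
  have : (of fun i j => (fun k => c k * b.repr (v i) k) ⬝ᵥ
        (S⁻¹ *ᵥ fun k => c k * b.repr (v j) k)) =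
      (diagonal c * b.toMatrix v)ᵀ * S⁻¹ * (diagonal c * b.toMatrix v) := by
    ext i j
    rw [Matrix.mul_assoc, of_apply, mul_apply]
    simp only [mul_apply (M := S⁻¹), dotProduct, mulVec, transpose_apply, diagonal_mul,
      Module.Basis.toMatrix_apply]
  rw [this, det_mul, det_mul, det_transpose, det_mul, det_diagonal, det_nonsing_inv,
    Ring.inverse_eq_inv', b.det_apply]
  rw [show (∏ i, c i) * (b.toMatrix v).det * (S.det)⁻¹ * ((∏ i, c i) * (b.toMatrix v).det) =
    ((∏ i, c i) * (b.toMatrix v).det) ^ 2 * (S.det)⁻¹ by ring, abs_mul, abs_of_pos (inv_pos.2 hS),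
    abs_pow, Real.sqrt_mul (by positivity), Real.sqrt_sq (abs_nonneg _), Real.sqrt_inv, abs_mul]

/-- The squared sub-Riemannian norm generated by finitely many vectors. -/
noncomputable def spanSqNorm (x : α → E) (v : E) : ℝ≥0∞ :=
  ⨅ (u : α → ℝ) (_ : ∑ i, u i • x i = v), ENNReal.ofReal (∑ i, u i ^ 2)

theorem spanSqNorm_eq_of_isLeast {x : α → E} {v : E} {q : ℝ}
    (h : IsLeast {q | ∃ u : α → ℝ, ∑ i, u i • x i = v ∧ q = ∑ i, u i ^ 2} q) :
    (spanSqNorm x v).toReal = q := by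
  obtain ⟨⟨u, hu, rfl⟩, hle⟩ := h
  have : spanSqNorm x v = ENNReal.ofReal (∑ i, u i ^ 2) := by
    refine le_antisymm (iInf₂_le u hu) (le_iInf₂ fun u' hu' => ?_)
    exact ENNReal.ofReal_le_ofReal (hle ⟨u', hu', rfl⟩)
  rw [this, ENNReal.toReal_ofReal (Finset.sum_nonneg fun i _ => sq_nonneg _)]

/-- If part of a basis is orthonormal for the norm generated by the vectors `x i`, the coordinates
of the `x i` satisfy `∑ i, x i k * x i l = δ k l`. -/
theorem sum_repr_mul_repr_of_orthonormal {x : α → E} {b : Module.Basis (Fin d) ℝ E} {n : ℕ}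
    (hspan : Submodule.span ℝ (b '' {k | (k : ℕ) < n}) = Submodule.span ℝ (Set.range x))
    (horth : ∀ k l : Fin d, (k : ℕ) < n → (l : ℕ) < n →
      ((spanSqNorm x (b k + b l)).toReal - (spanSqNorm x (b k)).toReal
        - (spanSqNorm x (b l)).toReal) / 2 = if k = l then 1 else 0)
    {k l : Fin d} (hk : (k : ℕ) < n) (hl : (l : ℕ) < n) :
    ∑ i, b.repr (x i) k * b.repr (x i) l = if k = l then 1 else 0 := by
  -- The other coordinates of the `x i` vanish, so `A` is the whole coordinate matrix. The generated
  -- norm on the span is y ↦ yᵀ(A Aᵀ)⁻¹y.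
  let A : Matrix {k : Fin d // (k : ℕ) < n} α ℝ := of fun k i => b.repr (x i) k
  have hx : ∀ (i : α) (k : Fin d), ¬ (k : ℕ) < n → b.repr (x i) k = 0 := fun i k hk =>
    repr_eq_zero_of_mem_span (s := {k | (k : ℕ) < n})
      (hspan ▸ Submodule.subset_span ⟨i, rfl⟩) hk
  have hdet : 0 < (A * Aᵀ).det := by
    refine det_mul_transpose_pos _ fun y hy => funext fun k => ?_
    let φ : E →ₗ[ℝ] ℝ := ∑ k, y k • b.coord k.1
    have hφ : ∀ v, φ v = ∑ k, y k * b.repr v k.1 := fun v => by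
      simp only [φ, LinearMap.sum_apply, LinearMap.smul_apply, smul_eq_mul,
        Module.Basis.coord_apply]
    have hker : Submodule.span ℝ (Set.range x) ≤ LinearMap.ker φ := by
      rw [Submodule.span_le]
      rintro _ ⟨i, rfl⟩
      simp only [SetLike.mem_coe, LinearMap.mem_ker, hφ]
      exact congrFun hy i
    have : b k.1 ∈ LinearMap.ker φ := hker (by
      rw [← hspan]; exact Submodule.subset_span ⟨k.1, k.2, rfl⟩)
    rw [LinearMap.mem_ker, hφ, Finset.sum_eq_single k] at this
    · simpa using this
    · intro l _ hl
      simp [Subtype.coe_injective.ne hl.symm]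
    · simp
  have hnorm : ∀ y : {k : Fin d // (k : ℕ) < n} → ℝ, (spanSqNorm x (∑ k, y k • b k.1)).toReal =
      y ⬝ᵥ ((A * Aᵀ)⁻¹ *ᵥ y) := by
    intro y
    refine spanSqNorm_eq_of_isLeast ?_
    convert isLeast_sum_sq A hdet.ne'.isUnit y using 1
    have key : ∀ u : α → ℝ, ∑ i, u i • x i = ∑ k, y k • b k.1 ↔ A *ᵥ u = y := by
      intro u
      rw [← b.repr.injective.eq_iff, DFunLike.ext_iff, funext_iff]
      have h1 : ∀ k, b.repr (∑ i, u i • x i) k = ∑ i, b.repr (x i) k * u i := fun k => by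
        simp [map_sum, Finsupp.coe_finsetSum, Finset.sum_apply, mul_comm]
      have h2 : ∀ (k : Fin d) (hk : (k : ℕ) < n), b.repr (∑ l, y l • b l.1) k = y ⟨k, hk⟩ := by
        intro k hk
        rw [map_sum, Finsupp.coe_finsetSum, Finset.sum_apply, Finset.sum_eq_single ⟨k, hk⟩]
        · simp
        · rintro l - hl
          have : l.1 ≠ k := fun h => hl (Subtype.ext h)
          simp [this]
        · simp
      constructor
      · rintro h ⟨k, hk⟩
        rw [← h2 k hk, ← h k, h1]
        rfl
      · intro h k
        rw [h1]
        by_cases hk : (k : ℕ) < n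
        · rw [h2 k hk, ← h ⟨k, hk⟩]; rfl
        · rw [Finset.sum_eq_zero fun i _ => by rw [hx i k hk, zero_mul]]
          symm
          refine repr_eq_zero_of_mem_span (s := {k | (k : ℕ) < n}) ?_ hk
          exact Submodule.sum_mem _ fun l _ => Submodule.smul_mem _ _
            (Submodule.subset_span ⟨l.1, l.2, rfl⟩)
    simp only [key]
  -- Orthonormality says that the polarized form (A Aᵀ)⁻¹ is the identity; the claim is the inverse
  -- of this statement.
  have hone : (A * Aᵀ)⁻¹ = 1 := by
    ext k l
    have h3 := horth k.1 l.1 k.2 l.2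
    have hs : ∀ k : {k : Fin d // (k : ℕ) < n},
        b k.1 = ∑ l, (Pi.single k (1 : ℝ) : _ → ℝ) l • b l.1 := fun k => by
      rw [Finset.sum_eq_single k]
      · simp
      · intro l _ hl; simp [hl]
      · simp
    have hs2 : b k.1 + b l.1 =
        ∑ j, ((Pi.single k (1 : ℝ) : _ → ℝ) + (Pi.single l (1 : ℝ) : _ → ℝ)) j • b j.1 := by
      simp only [Pi.add_apply, add_smul, Finset.sum_add_distrib, ← hs]
    rw [hs2, hs k, hs l, hnorm, hnorm, hnorm, polarization _ (transpose_inv_mul_transpose A)] at h3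
    rw [one_apply]
    simpa [Subtype.ext_iff] using h3
  have h4 : A * Aᵀ = 1 := by
    have := mul_nonsing_inv _ hdet.ne'.isUnit
    rwa [hone, mul_one] at this
  have h5 := congrFun (congrFun h4 ⟨k, hk⟩) ⟨l, hl⟩
  rw [mul_apply, one_apply] at h5
  simpa [A, Subtype.ext_iff] using h5

/-- Linear combinations of the vectors `x i`, orthonormal for the norm which these generate, and
spanning the same space. -/
theorem exists_orthonormal_combinations (x : α → E) :
    ∃ c : Fin (Module.finrank ℝ (Submodule.span ℝ (Set.range x))) → α → ℝ,
      LinearIndependent ℝ (fun k => ∑ i, c k i • x i) ∧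
      ∀ k l, ((spanSqNorm x (∑ i, c k i • x i + ∑ i, c l i • x i)).toReal
        - (spanSqNorm x (∑ i, c k i • x i)).toReal
        - (spanSqNorm x (∑ i, c l i • x i)).toReal) / 2 = if k = l then 1 else 0 := by
  let σ : EuclideanSpace ℝ α →ₗ[ℝ] E :=
    (Fintype.linearCombination ℝ x) ∘ₗ (WithLp.linearEquiv 2 ℝ (α → ℝ)).toLinearMap
  have hσ : ∀ u, σ u = ∑ i, u i • x i := fun u => by
    simp [σ, Fintype.linearCombination_apply]
  have hrange : LinearMap.range σ = Submodule.span ℝ (Set.range x) := by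
    rw [LinearMap.range_comp, LinearEquiv.range, Submodule.map_top,
      Fintype.range_linearCombination]
  have hdim : Module.finrank ℝ (LinearMap.ker σ)ᗮ =
      Module.finrank ℝ (Submodule.span ℝ (Set.range x)) := by
    have h1 := LinearMap.finrank_range_add_finrank_ker σ
    have h2 := Submodule.finrank_add_finrank_orthogonal (LinearMap.ker σ)
    rw [hrange] at h1
    omega
  -- A vector orthogonal to the kernel is the shortest preimage of its image, so σ is isometric
  -- there; an orthonormal basis of this complement supplies the coefficients `c`.
  have hnorm : ∀ u ∈ (LinearMap.ker σ)ᗮ, (spanSqNorm x (σ u)).toReal = ‖u‖ ^ 2 := by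
    intro u hu
    refine spanSqNorm_eq_of_isLeast ⟨⟨u, (hσ u).symm, ?_⟩, ?_⟩
    · rw [EuclideanSpace.real_norm_sq_eq]
    · rintro q ⟨u', hu', rfl⟩
      have hk : WithLp.toLp 2 u' - u ∈ LinearMap.ker σ := by
        rw [LinearMap.mem_ker, map_sub, hσ (WithLp.toLp 2 u'), hu', sub_self]
      have h0 : inner ℝ (WithLp.toLp 2 u' - u) u = 0 := hu _ hk
      have h1 := norm_add_sq_real (WithLp.toLp 2 u' - u) u
      rw [sub_add_cancel, h0, EuclideanSpace.real_norm_sq_eq] at h1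
      have h2 := sq_nonneg ‖WithLp.toLp 2 u' - u‖
      simp only at h1
      linarith
  let e := (stdOrthonormalBasis ℝ (LinearMap.ker σ)ᗮ).reindex (finCongr hdim)
  have hinj : LinearMap.ker (σ ∘ₗ (LinearMap.ker σ)ᗮ.subtype) = ⊥ := by
    rw [LinearMap.ker_eq_bot']
    intro u hu
    have : (u : EuclideanSpace ℝ α) ∈ LinearMap.ker σ ⊓ (LinearMap.ker σ)ᗮ := ⟨hu, u.2⟩
    rw [Submodule.inf_orthogonal_eq_bot] at this
    exact Subtype.ext this
  refine ⟨fun k => (e k : EuclideanSpace ℝ α), ?_, fun k l => ?_⟩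
  · have := (e.toBasis.linearIndependent).map' _ hinj
    have hfun : (fun k => ∑ i, (e k : EuclideanSpace ℝ α) i • x i) =
        (σ ∘ₗ (LinearMap.ker σ)ᗮ.subtype) ∘ e.toBasis := funext fun k => by simp [hσ]
    rw [hfun]
    exact this
  · simp only [← hσ]
    rw [← map_add, hnorm _ (Submodule.add_mem _ (e k).2 (e l).2), hnorm _ (e k).2,
      hnorm _ (e l).2, norm_add_sq_real, ← Submodule.coe_inner]
    have := orthonormal_iff_ite.1 e.orthonormal k l
    rw [this]; ring

end LinearAlgebra

/-! ### Smooth vector fields and the Leibniz rule for brackets -/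

section Fields

open VectorField

variable {d : ℕ} {M : Type*} [TopologicalSpace M] [ChartedSpace (EuclideanSpace ℝ (Fin d)) M]
  [IsManifold (𝓡 d) ∞ M] {m : M} {U V W : VField d M}

/-- Smoothness of a vector field at a point. -/
def SmoothAt (W : VField d M) (m : M) : Prop :=
  ContMDiffAt (𝓡 d) (𝓡 d).tangent ∞ (fun p => (⟨p, W p⟩ : TangentBundle (𝓡 d) M)) m

theorem SmoothAt.mdifferentiableAt (h : SmoothAt W m) :
    MDifferentiableAt (𝓡 d) (𝓡 d).tangent (fun p => (⟨p, W p⟩ : TangentBundle (𝓡 d) M)) m :=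
  ContMDiffAt.mdifferentiableAt h (by simp)

theorem SmoothAt.add (hV : SmoothAt V m) (hW : SmoothAt W m) : SmoothAt (V + W) m :=
  ContMDiffAt.add_section hV hW

theorem SmoothAt.const_smul (c : ℝ) (hW : SmoothAt W m) : SmoothAt (c • W) m :=
  ContMDiffAt.const_smul_section hW

theorem SmoothAt.sum {ι : Type*} {s : Finset ι} {W : ι → VField d M}
    (h : ∀ i ∈ s, SmoothAt (W i) m) : SmoothAt (∑ i ∈ s, W i) m := by
  have := ContMDiffAt.sum_section (s := s) (t := W) h
  unfold SmoothAt
  convert this using 3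
  simp

theorem smoothAt_zero : SmoothAt (0 : VField d M) m := by
  simpa using SmoothAt.sum (s := (∅ : Finset ℕ)) (W := fun _ => (0 : VField d M)) (m := m) (by simp)

theorem SmoothAt.sub (hV : SmoothAt V m) (hW : SmoothAt W m) : SmoothAt (V - W) m :=
  ContMDiffAt.sub_section hV hW

theorem SmoothAt.mlieBracket (hV : SmoothAt V m) (hW : SmoothAt W m) :
    SmoothAt (mlieBracket (𝓡 d) V W) m := by
  have : IsManifold (𝓡 d) ((⊤ : ℕ∞) + 1) M := by simpa using (inferInstance : IsManifold (𝓡 d) ∞ M)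
  have : IsManifold (𝓡 d) (minSmoothness ℝ 2) M := by
    rw [minSmoothness_of_isRCLikeNormedField]; infer_instance
  exact ContMDiffAt.mlieBracket_vectorField (n := ⊤) (m := ⊤) hV hW (by simp)

theorem mlieBracket_sum_smul {ι : Type*} (s : Finset ι) {f : ι → M → ℝ} {Y : ι → VField d M}
    (hf : ∀ i ∈ s, MDifferentiableAt (𝓡 d) 𝓘(ℝ, ℝ) (f i) m) (hY : ∀ i ∈ s, SmoothAt (Y i) m) :
    mlieBracket (𝓡 d) U (∑ i ∈ s, f i • Y i) m =
      ∑ i ∈ s, (mvfderiv (𝓡 d) (f i) m (U m) • Y i m + f i m • mlieBracket (𝓡 d) U (Y i) m) := by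
  classical
  induction s using Finset.induction_on with
  | empty => simp
  | insert i s hi ih =>
    have h1 : ∀ j ∈ insert i s, MDifferentiableAt (𝓡 d) (𝓡 d).tangent
        (fun p => (⟨p, (f j • Y j) p⟩ : TangentBundle (𝓡 d) M)) m := fun j hj =>
      MDifferentiableAt.smul_section (hf j hj) (hY j hj).mdifferentiableAt
    rw [Finset.sum_insert hi, Finset.sum_insert hi, mlieBracket_add_right (h1 i (by simp)), ih,
      mlieBracket_smul_right (hf i (by simp)) (hY i (by simp)).mdifferentiableAt]
    · exact fun j hj => hf j (Finset.mem_insert_of_mem hj)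
    · exact fun j hj => hY j (Finset.mem_insert_of_mem hj)
    · have := MDifferentiableAt.sum_section (s := s) (t := fun j => f j • Y j) (x₀ := m)
        (fun j hj => h1 j (Finset.mem_insert_of_mem hj))
      convert this using 3
      simp

end Fields

/-! ### Smoothness of frame coefficients -/

section Coefficients

open Bundle Matrix

variable {d : ℕ} {M : Type*} [TopologicalSpace M] [ChartedSpace (EuclideanSpace ℝ (Fin d)) M]
  [IsManifold (𝓡 d) ∞ M] {m : M}

omit [IsManifold (𝓡 d) ∞ M] in
theorem contMDiffAt_det {n : ℕ} {A : M → Matrix (Fin n) (Fin n) ℝ}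
    (hA : ∀ i j, ContMDiffAt (𝓡 d) 𝓘(ℝ, ℝ) ∞ (fun p => A p i j) m) :
    ContMDiffAt (𝓡 d) 𝓘(ℝ, ℝ) ∞ (fun p => (A p).det) m := by
  simp only [Matrix.det_apply, Units.smul_def, zsmul_eq_mul]
  refine contMDiffAt_finsetSum fun σ _ => ContMDiffAt.mul contMDiffAt_const ?_
  exact contMDiffAt_finsetProd fun i _ => hA _ _

/-- In a trivialization the coefficients solve a linear system with smooth data, and Cramer's rule
writes them as quotients of smooth functions. -/
theorem contMDiffAt_coeff {O : Set M} (hO : IsOpen O) {Y : Fin d → VField d M}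
    (hY : IsLocalFrameOn (𝓡 d) (EuclideanSpace ℝ (Fin d)) ∞ Y O) {W : VField d M}
    (hm : m ∈ O) (hW : SmoothAt W m) (k : Fin d) :
    ContMDiffAt (𝓡 d) 𝓘(ℝ, ℝ) ∞ (fun p => hY.coeff k p (W p)) m := by
  let e := trivializationAt (EuclideanSpace ℝ (Fin d)) (TangentSpace (𝓡 d) (M := M)) m
  have hme : m ∈ e.baseSet := FiberBundle.mem_baseSet_trivializationAt' m
  let b := (EuclideanSpace.basisFun (Fin d) ℝ).toBasis
  let A : M → Matrix (Fin d) (Fin d) ℝ := fun p =>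
    Matrix.of fun i j => e.localFrameCoeff (𝓡 d) b i p (Y j p)
  let y : M → Fin d → ℝ := fun p i => e.localFrameCoeff (𝓡 d) b i p (W p)
  have hA : ∀ i j, ContMDiffAt (𝓡 d) 𝓘(ℝ, ℝ) ∞ (fun p => A p i j) m := fun i j =>
    contMDiffAt_localFrameCoeff b hme (hY.contMDiffAt hO hm j) i
  have hy : ∀ i, ContMDiffAt (𝓡 d) 𝓘(ℝ, ℝ) ∞ (fun p => y p i) m := fun i =>
    contMDiffAt_localFrameCoeff b hme hW i
  have hcr : ∀ i, ContMDiffAt (𝓡 d) 𝓘(ℝ, ℝ) ∞ (fun p => (A p).cramer (y p) i) m := by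
    intro i
    simp only [Matrix.cramer_apply]
    refine contMDiffAt_det fun j l => ?_
    by_cases hl : l = i
    · subst hl; simpa using hy j
    · simpa [hl] using hA j l
  have hdet : ∀ p ∈ O ∩ e.baseSet, (A p).det ≠ 0 := by
    rintro p ⟨hpO, hpe⟩
    have : A p = (e.basisAt b hpe).toMatrix (hY.toBasisAt hpO) := by
      ext i j
      simp [A, Module.Basis.toMatrix_apply, e.localFrameCoeff_apply_of_mem_baseSet b hpe (Y j)]
    rw [this]
    have := (e.basisAt b hpe).invertibleToMatrix (hY.toBasisAt hpO)
    exact ((Matrix.isUnit_iff_isUnit_det _).1 (isUnit_of_invertible _)).ne_zero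
  have heq : ∀ p ∈ O ∩ e.baseSet, hY.coeff k p (W p) = (A p).cramer (y p) k / (A p).det := by
    rintro p ⟨hpO, hpe⟩
    have h1 : A p *ᵥ (fun k => hY.coeff k p (W p)) = y p := by
      funext i
      have := hY.coeff_sum_eq W hpO
      simp only [y]
      conv_rhs => rw [this]
      simp [Matrix.mulVec, dotProduct, A, mul_comm]
    rw [eq_div_iff (hdet p ⟨hpO, hpe⟩), ← h1, Matrix.cramer_eq_adjugate_mulVec,
      Matrix.mulVec_mulVec, Matrix.adjugate_mul, Matrix.smul_mulVec, Matrix.one_mulVec]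
    simp [mul_comm]
  have hnhds : O ∩ e.baseSet ∈ 𝓝 m :=
    Filter.inter_mem (hO.mem_nhds hm) (e.open_baseSet.mem_nhds hme)
  refine ContMDiffAt.congr_of_eventuallyEq (f := fun p => (A p).cramer (y p) k / (A p).det) ?_
    (Filter.eventually_of_mem hnhds heq)
  exact (hcr k).div₀ (contMDiffAt_det hA) (hdet m ⟨hm, hme⟩)

/-- Linear independence of smooth fields is an open condition. -/
theorem eventually_linearIndependent {Y : Fin d → VField d M} (hY : ∀ k, SmoothAt (Y k) m)
    (h : LinearIndependent ℝ fun k => Y k m) :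
    ∀ᶠ p in 𝓝 m, LinearIndependent ℝ fun k => Y k p := by
  let e := trivializationAt (EuclideanSpace ℝ (Fin d)) (TangentSpace (𝓡 d) (M := M)) m
  have hme : m ∈ e.baseSet := FiberBundle.mem_baseSet_trivializationAt' m
  let b := (EuclideanSpace.basisFun (Fin d) ℝ).toBasis
  let A : M → Matrix (Fin d) (Fin d) ℝ := fun p =>
    Matrix.of fun i j => e.localFrameCoeff (𝓡 d) b i p (Y j p)
  have hA : ContinuousAt (fun p => (A p).det) m := (contMDiffAt_det fun i j =>
    contMDiffAt_localFrameCoeff b hme (hY j) i).continuousAt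
  have hiff : ∀ p ∈ e.baseSet, (A p).det ≠ 0 ↔ LinearIndependent ℝ fun k => Y k p := by
    intro p hpe
    have : (A p).det = (e.basisAt b hpe).det fun k => Y k p := by
      rw [Module.Basis.det_apply]
      congr 1
      ext i j
      simp [A, Module.Basis.toMatrix_apply, e.localFrameCoeff_apply_of_mem_baseSet b hpe (Y j)]
    rw [this, ← isUnit_iff_ne_zero, ← Module.Basis.is_basis_iff_det]
    have := Module.Finite.of_basis (e.basisAt b hpe)
    refine ⟨fun h => h.1, fun h => ⟨h, h.span_eq_top_of_card_eq_finrank' ?_⟩⟩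
    rw [Module.finrank_eq_card_basis (e.basisAt b hpe)]
  filter_upwards [hA.eventually_ne ((hiff m hme).2 h), e.open_baseSet.mem_nhds hme] with p hp hpe
  exact (hiff p hpe).1 hp

end Coefficients

/-! ### The flag and the iterated brackets that span it -/

section Flag

open VectorField

variable {d : ℕ} {M : Type*} [TopologicalSpace M] [ChartedSpace (EuclideanSpace ℝ (Fin d)) M]
  {N₀ : ℕ} {X : Fin N₀ → VField d M} {r : ℕ} {m : M}

theorem flag_mono : Monotone (flag X) :=
  monotone_nat_of_le_succ fun _ => le_sup_left

theorem flagAt_mono (m : M) : Monotone fun i => flagAt X i m :=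
  fun _ _ h => Submodule.map_mono (flag_mono h)

theorem apply_mem_flagAt {i : ℕ} {W : VField d M} (h : W ∈ flag X i) (m : M) :
    W m ∈ flagAt X i m :=
  ⟨W, h, rfl⟩

theorem mlieBracket_mem_flag {i : ℕ} {U V : VField d M} (hU : U ∈ flag X 0) (hV : V ∈ flag X i) :
    mlieBracket (𝓡 d) U V ∈ flag X (i + 1) :=
  (le_sup_right : _ ≤ flag X (i + 1)) (Submodule.subset_span ⟨U, hU, V, hV, rfl⟩)

theorem iterBracket_mem_flag (k : ℕ) (I : Fin (k + 1) → Fin N₀) : iterBracket X k I ∈ flag X k := by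
  induction k with
  | zero => exact Submodule.subset_span ⟨_, rfl⟩
  | succ k ih => exact mlieBracket_mem_flag (Submodule.subset_span ⟨_, rfl⟩) (ih _)

instance finiteDimensional_tangentSpace (m : M) : FiniteDimensional ℝ (TangentSpace (𝓡 d) m) :=
  inferInstanceAs (FiniteDimensional ℝ (EuclideanSpace ℝ (Fin d)))

theorem finrank_tangentSpace (m : M) : Module.finrank ℝ (TangentSpace (𝓡 d) m) = d :=
  (finrank_euclideanSpace_fin : Module.finrank ℝ (EuclideanSpace ℝ (Fin d)) = d)

theorem growth_mono (m : M) : Monotone fun i => growth X i m :=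
  fun _ _ h => Submodule.finrank_mono (flagAt_mono m h)

theorem flagAt_eq_top (hH : Hormander X) (hr : IsGreatest (Set.range (stepAt X)) r) {i : ℕ}
    (hi : r ≤ i) (m : M) : flagAt X i m = ⊤ := by
  have h1 : flagAt X (stepAt X m) m = ⊤ := Nat.sInf_mem (s := {i | flagAt X i m = ⊤}) (hH m)
  exact top_le_iff.1 (h1 ▸ flagAt_mono m ((hr.2 ⟨m, rfl⟩).trans hi))

theorem growth_eq (htop : ∀ i, r ≤ i → ∀ m, flagAt X i m = ⊤) {i : ℕ}
    (hi : r ≤ i) (m : M) : growth X i m = d := by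
  rw [growth, htop i hi m, finrank_top, finrank_tangentSpace]

variable [IsManifold (𝓡 d) ∞ M]

theorem smoothAt_of_mem_flag (hX : ∀ i m, SmoothAt (X i) m) {i : ℕ} {W : VField d M}
    (hW : W ∈ flag X i) (m : M) : SmoothAt W m := by
  have hspan : ∀ (s : Set (VField d M)), (∀ V ∈ s, ∀ m, SmoothAt V m) →
      ∀ V ∈ Submodule.span ℝ s, ∀ m, SmoothAt V m := by
    intro s hs V hV
    induction hV using Submodule.span_induction with
    | mem V hV => exact hs V hV
    | zero => exact fun _ => smoothAt_zero
    | add U V _ _ hU hV => exact fun m => (hU m).add (hV m)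
    | smul c U _ hU => exact fun m => (hU m).const_smul c
  have h0 := hspan (Set.range X) (by rintro _ ⟨i, rfl⟩; exact hX i)
  revert m
  induction i generalizing W with
  | zero => exact h0 W hW
  | succ i ih =>
    obtain ⟨U, hU, V, hV, rfl⟩ := Submodule.mem_sup.1 hW
    refine fun m => (ih hU m).add (hspan _ ?_ V hV m)
    rintro _ ⟨A, hA, B, hB, rfl⟩ p
    exact (h0 A hA p).mlieBracket (ih hB p)

/-- The flag is spanned by the iterated brackets of the given fields. -/
theorem flag_le_span (hX : ∀ i m, SmoothAt (X i) m) (i : ℕ) :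
    flag X i ≤ Submodule.span ℝ {W | ∃ k ≤ i, ∃ I, W = iterBracket X k I} := by
  induction i with
  | zero =>
    refine Submodule.span_le.2 ?_
    rintro _ ⟨i, rfl⟩
    exact Submodule.subset_span ⟨0, le_rfl, fun _ => i, rfl⟩
  | succ i ih =>
    refine sup_le (ih.trans (Submodule.span_mono ?_)) (Submodule.span_le.2 ?_)
    · rintro _ ⟨k, hk, I, rfl⟩
      exact ⟨k, hk.trans i.le_succ, I, rfl⟩
    rintro _ ⟨U, hU, V, hV, rfl⟩
    -- Additivity of the bracket needs differentiable fields. Elements of the span of the brackets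
    -- are smooth because they belong to the flag.
    have hbr : ∀ {s : Set (VField d M)}, s ⊆ flag X i → ∀ V ∈ Submodule.span ℝ s,
        V ∈ flag X i := fun hs V hV => Submodule.span_le.2 hs hV
    have hgen : {W | ∃ k ≤ i, ∃ I, W = iterBracket X k I} ⊆ (flag X i : Set (VField d M)) := by
      rintro _ ⟨k, hk, I, rfl⟩
      exact flag_mono hk (iterBracket_mem_flag k I)
    induction hU using Submodule.span_induction with
    | zero => simp
    | add A B hA hB ihA ihB =>
      have : mlieBracket (𝓡 d) (A + B) V = mlieBracket (𝓡 d) A V + mlieBracket (𝓡 d) B V :=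
        funext fun p => mlieBracket_add_left
          (smoothAt_of_mem_flag (i := 0) hX hA p).mdifferentiableAt
          (smoothAt_of_mem_flag (i := 0) hX hB p).mdifferentiableAt
      rw [this]
      exact Submodule.add_mem _ ihA ihB
    | smul c A hA ihA =>
      have : mlieBracket (𝓡 d) (c • A) V = c • mlieBracket (𝓡 d) A V :=
        funext fun p => mlieBracket_const_smul_left
          (smoothAt_of_mem_flag (i := 0) hX hA p).mdifferentiableAt
      rw [this]
      exact Submodule.smul_mem _ _ ihA
    | mem A hA =>
      obtain ⟨a, rfl⟩ := hA
      have hV' := ih hV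
      clear hV
      induction hV' using Submodule.span_induction with
      | zero => simp
      | add A B hA hB ihA ihB =>
        have : mlieBracket (𝓡 d) (X a) (A + B) =
            mlieBracket (𝓡 d) (X a) A + mlieBracket (𝓡 d) (X a) B :=
          funext fun p => mlieBracket_add_right
            (smoothAt_of_mem_flag hX (hbr hgen A hA) p).mdifferentiableAt
            (smoothAt_of_mem_flag hX (hbr hgen B hB) p).mdifferentiableAt
        rw [this]
        exact Submodule.add_mem _ ihA ihB
      | smul c A hA ihA =>
        have : mlieBracket (𝓡 d) (X a) (c • A) = c • mlieBracket (𝓡 d) (X a) A :=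
          funext fun p => mlieBracket_const_smul_right
            (smoothAt_of_mem_flag hX (hbr hgen A hA) p).mdifferentiableAt
        rw [this]
        exact Submodule.smul_mem _ _ ihA
      | mem A hA =>
        obtain ⟨k, hk, I, rfl⟩ := hA
        refine Submodule.subset_span ⟨k + 1, Nat.succ_le_succ hk, Fin.cons a I, ?_⟩
        simp [iterBracket]

theorem flagAt_eq_span (hX : ∀ i m, SmoothAt (X i) m) {i : ℕ} (hi : i ≤ r) (m : M) :
    flagAt X i m = Submodule.span ℝ
      ((fun a : BracketIndex X r => iterBracket X a.1 a.2.1 m) '' {a | (a.1 : ℕ) ≤ i}) := by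
  refine le_antisymm ?_ (Submodule.span_le.2 ?_)
  · refine (Submodule.map_mono (flag_le_span hX i)).trans ?_
    rw [Submodule.map_span, Submodule.span_le]
    rintro _ ⟨_, ⟨k, hk, I, rfl⟩, rfl⟩
    by_cases h : IsBracketIndex X k I
    · exact Submodule.subset_span ⟨⟨⟨k, by omega⟩, I, h⟩, hk, rfl⟩
    · simp only [IsBracketIndex, not_or, not_exists, not_not] at h
      have : (LinearMap.proj m : VField d M →ₗ[ℝ] _) (iterBracket X k I) = 0 := h.2 m
      rw [this]
      exact Submodule.zero_mem _
  · rintro _ ⟨a, ha, rfl⟩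
    exact flagAt_mono m ha (apply_mem_flagAt (iterBracket_mem_flag _ _) m)

end Flag

/-! ### Weights and the homogeneous dimension -/

section Weight

variable {d : ℕ} {M : Type*} [TopologicalSpace M] [ChartedSpace (EuclideanSpace ℝ (Fin d)) M]
  {N₀ : ℕ} {X : Fin N₀ → VField d M} {r : ℕ} {m : M}

/-- The least `i` with `k < n i`. -/
noncomputable def weight (n : ℕ → ℕ) (k : ℕ) : ℕ := sInf {i | k < n i}

theorem weight_le_iff {n : ℕ → ℕ} (hn : Monotone n) {k : ℕ} (hk : ∃ i, k < n i) {i : ℕ} :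
    weight n k ≤ i ↔ k < n i := by
  refine ⟨fun h => ?_, fun h => Nat.sInf_le h⟩
  exact lt_of_lt_of_le (Nat.sInf_mem (s := {i | k < n i}) hk) (hn h)

theorem weight_growth_eq_iff {k : ℕ} (hk : ∃ i, k < growth X i m) {j : ℕ} :
    weight (growth X · m) k = j ↔ prevGrowth X j m ≤ k ∧ k < growth X j m := by
  have h := @weight_le_iff (growth X · m) (growth_mono m) k hk
  cases j with
  | zero => simp [prevGrowth, ← h]
  | succ j =>
    have h1 := @h j
    have h2 := @h (j + 1)
    simp only [prevGrowth]
    rw [← h2, ← not_lt, ← h1]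
    omega

/-- Exactly n_j - n_{j-1} indices have weight j, so ∑ (w + 1) over the d indices is the homogeneous
dimension. -/
theorem sum_weight_eq (htop : ∀ i, r ≤ i → ∀ m, flagAt X i m = ⊤) (m : M) :
    ((∑ k : Fin d, weight (growth X · m) k : ℕ) : ℤ) = homDim X r m - d := by
  have hk : ∀ k : Fin d, (k : ℕ) < growth X r m := fun k => by
    rw [growth_eq htop le_rfl]; exact k.2
  have hle : ∀ j, growth X j m ≤ d := fun j =>
    (growth_mono m (le_max_left j r)).trans (growth_eq htop (le_max_right j r) m).le
  have hcard : ∀ j, ((Finset.univ.filter fun k : Fin d => weight (growth X · m) k = j).card : ℤ) =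
      growth X j m - prevGrowth X j m := by
    intro j
    have hprev : prevGrowth X j m ≤ growth X j m := by
      cases j with
      | zero => exact Nat.zero_le _
      | succ j => exact growth_mono m j.le_succ
    have : (Finset.univ.filter fun k : Fin d => weight (growth X · m) k = j).card =
        (Finset.Ico (prevGrowth X j m) (growth X j m)).card := by
      refine Finset.card_bij (fun k _ => (k : ℕ)) ?_ (fun a _ b _ h => Fin.ext h) ?_
      · intro k h
        simpa using (weight_growth_eq_iff ⟨r, hk k⟩).1 (Finset.mem_filter.1 h).2
      · intro k h
        have h' := Finset.mem_Ico.1 h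
        refine ⟨⟨k, h'.2.trans_le (hle j)⟩, ?_, rfl⟩
        simpa using (weight_growth_eq_iff ⟨r, hk ⟨k, h'.2.trans_le (hle j)⟩⟩).2 h'
    rw [this, Nat.card_Ico, Nat.cast_sub hprev]
  have h1 : ∑ k : Fin d, ((weight (growth X · m) k : ℤ) + 1) = homDim X r m := by
    rw [← Finset.sum_fiberwise_of_maps_to (t := Finset.range (r + 1))
      (g := fun k : Fin d => weight (growth X · m) k)]
    · refine Finset.sum_congr rfl fun j _ => ?_
      rw [Finset.sum_congr rfl (g := fun _ => (j : ℤ) + 1), Finset.sum_const, nsmul_eq_mul, hcard,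
        mul_comm]
      intro k hk'
      rw [(Finset.mem_filter.1 hk').2]
    · exact fun k _ => Finset.mem_range.2
        (Nat.lt_succ_of_le ((weight_le_iff (growth_mono m) ⟨r, hk k⟩).2 (hk k)))
  rw [Finset.sum_add_distrib] at h1
  simp only [Finset.sum_const, Finset.card_univ, Fintype.card_fin, nsmul_eq_mul, mul_one] at h1
  push_cast
  linarith

end Weight

/-! ### Construction of adapted frames -/

section Frames

open VectorField

variable {d : ℕ} {M : Type*} [TopologicalSpace M] [ChartedSpace (EuclideanSpace ℝ (Fin d)) M]
  {N₀ : ℕ} {X : Fin N₀ → VField d M} {r : ℕ} {m : M}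

theorem growth_le (i : ℕ) (m : M) : growth X i m ≤ d :=
  (Submodule.finrank_le _).trans (finrank_tangentSpace m).le

theorem finrank_span_range_eq_growth (m : M) :
    Module.finrank ℝ (Submodule.span ℝ (Set.range fun i => X i m)) = growth X 0 m := by
  have : flagAt X 0 m = Submodule.span ℝ (Set.range fun i => X i m) := by
    rw [flagAt, flag, Submodule.map_span, ← Set.range_comp]
    rfl
  rw [growth, this]

/-- At every point there are fields in the flag which form an adapted basis at that point. -/
theorem exists_flag_family (htop : ∀ i, r ≤ i → ∀ m, flagAt X i m = ⊤) (m : M) :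
    ∃ Y : Fin d → VField d M, LinearIndependent ℝ (fun k => Y k m) ∧
      (∀ (k : Fin d) i, (k : ℕ) < growth X i m → Y k ∈ flag X i) ∧
      ∀ k l : Fin d, (k : ℕ) < growth X 0 m → (l : ℕ) < growth X 0 m →
        subRiemInner X m (Y k m) (Y l m) = if k = l then 1 else 0 := by
  -- The family starts with n_0 orthonormal constant combinations of the given fields and is
  -- extended one field at a time.
  suffices H : ∀ n, growth X 0 m ≤ n → n ≤ d →
      ∃ Y : Fin n → VField d M, LinearIndependent ℝ (fun k => Y k m) ∧
      (∀ (k : Fin n) i, (k : ℕ) < growth X i m → Y k ∈ flag X i) ∧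
      ∀ k l : Fin n, (k : ℕ) < growth X 0 m → (l : ℕ) < growth X 0 m →
        subRiemInner X m (Y k m) (Y l m) = if k = l then 1 else 0 from
    H d (growth_le 0 m) le_rfl
  intro n hn
  induction n, hn using Nat.le_induction with
  | base =>
    intro _
    obtain ⟨c, hc, horth⟩ := exists_orthonormal_combinations fun i => X i m
    let e := finCongr (finrank_span_range_eq_growth (X := X) m).symm
    have hev : ∀ k, (∑ i, c (e k) i • X i) m = ∑ i, c (e k) i • X i m := fun k => by simp
    refine ⟨fun k => ∑ i, c (e k) i • X i, ?_, fun k i _ => ?_, fun k l _ _ => ?_⟩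
    · simp only [hev]
      exact hc.comp e e.injective
    · exact flag_mono (Nat.zero_le i) (Submodule.sum_mem _ fun j _ =>
        Submodule.smul_mem _ _ (Submodule.subset_span ⟨j, rfl⟩))
    · simp only [hev]
      have := horth (e k) (e l)
      simp only [e.injective.eq_iff] at this
      exact this
  | succ n hn ih =>
    intro hnd
    obtain ⟨Y, hY, hflag, horth⟩ := ih (by omega)
    have hex : ∃ i, n < growth X i m := ⟨r, by rw [growth_eq htop le_rfl]; omega⟩
    -- At the level given by the weight of n, the flag has dimension greater than n, so it is not
    -- exhausted by the n fields found so far. Choosing the new field at this level keeps the family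
    -- adapted.
    have hlt : ¬ flagAt X (weight (growth X · m) n) m ≤
        Submodule.span ℝ (Set.range fun k => Y k m) := by
      intro hle
      have h1 := Submodule.finrank_mono hle
      rw [finrank_span_eq_card hY, Fintype.card_fin] at h1
      exact absurd ((weight_le_iff (growth_mono m) hex).1 le_rfl) (not_lt.2 h1)
    obtain ⟨_, ⟨W, hW, rfl⟩, hnot⟩ := Set.not_subset.1 hlt
    have hev : (fun k => (Fin.snoc Y W : Fin (n + 1) → VField d M) k m) =
        Fin.snoc (fun k => Y k m) (W m) := by
      funext k
      refine Fin.lastCases ?_ (fun k => ?_) k <;> simp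
    refine ⟨Fin.snoc Y W, ?_, fun k => ?_, fun k l hk hl => ?_⟩
    · rw [hev, linearIndependent_finSnoc]
      exact ⟨hY, hnot⟩
    · refine Fin.lastCases ?_ (fun k => ?_) k
      · intro i hi
        rw [Fin.snoc_last]
        exact flag_mono ((weight_le_iff (growth_mono m) hex).2 hi) hW
      · simpa using hflag k
    · revert hk hl
      refine Fin.lastCases (fun h => absurd h (by simpa using hn)) (fun k => ?_) k
      refine Fin.lastCases (fun _ h => absurd h (by simpa using hn)) (fun l => ?_) l
      simpa using horth k l

/-- A frame of fields in the flag, adapted at all points of an open set. -/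
structure FlagFrame (X : Fin N₀ → VField d M) [IsManifold (𝓡 d) ∞ M] (n : ℕ → ℕ) (O : Set M)
    (Y : Fin d → VField d M) : Prop where
  isOpen : IsOpen O
  isFrame : IsLocalFrameOn (𝓡 d) (EuclideanSpace ℝ (Fin d)) ∞ Y O
  mem_flag : ∀ (k : Fin d) i, (k : ℕ) < n i → Y k ∈ flag X i
  growth_eq : ∀ p ∈ O, ∀ i, growth X i p = n i

variable [IsManifold (𝓡 d) ∞ M]

/-- Independence at `m` persists nearby, and the growth vector is locally constant, so by dimension
count the flag fields stay adapted on a neighbourhood. Orthonormality is only available at `m`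
itself. -/
theorem exists_flagFrame (hX : ∀ i m, SmoothAt (X i) m)
    (htop : ∀ i, r ≤ i → ∀ m, flagAt X i m = ⊤) (hm : m ∈ equiregularRegion X r) :
    ∃ O Y, FlagFrame X (growth X · m) O Y ∧ m ∈ O ∧
      ∀ k l : Fin d, (k : ℕ) < growth X 0 m → (l : ℕ) < growth X 0 m →
        subRiemInner X m (Y k m) (Y l m) = if k = l then 1 else 0 := by
  obtain ⟨Y, hY, hflag, horth⟩ := exists_flag_family htop m
  have hYs : ∀ k p, SmoothAt (Y k) p := fun k p => smoothAt_of_mem_flag hX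
    (hflag k r (by rw [growth_eq htop le_rfl]; exact k.2)) p
  obtain ⟨O, hO, hOo, hmO⟩ := eventually_nhds_iff.1
    ((eventually_linearIndependent (fun k => hYs k m) hY).and hm)
  refine ⟨O, Y, ⟨hOo, ⟨fun hx => (hO _ hx).1, fun {p} hx => ?_, fun k p _ =>
    ContMDiffAt.contMDiffWithinAt (hYs k p)⟩, hflag, fun p hp i => ?_⟩, hmO, horth⟩
  · rw [(hO _ hx).1.span_eq_top_of_card_eq_finrank' (by
      rw [Fintype.card_fin, finrank_tangentSpace])]
  · rcases le_total i r with hi | hi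
    · exact (hO p hp).2 i hi
    · rw [growth_eq htop hi, growth_eq htop hi]

omit [IsManifold (𝓡 d) ∞ M] in
theorem span_image_eq_flagAt {p : M} {Y : Fin d → TangentSpace (𝓡 d) p}
    (hY : LinearIndependent ℝ Y) {i : ℕ}
    (hmem : ∀ k : Fin d, (k : ℕ) < growth X i p → Y k ∈ flagAt X i p) :
    Submodule.span ℝ (Y '' {k : Fin d | (k : ℕ) < growth X i p}) = flagAt X i p := by
  refine Submodule.eq_of_le_of_finrank_eq (Submodule.span_le.2 ?_) ?_
  · rintro _ ⟨k, hk, rfl⟩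
    exact hmem k hk
  · rw [Set.image_eq_range]
    have : Fintype.card {k : Fin d // (k : ℕ) < growth X i p} = growth X i p := by
      rw [Fintype.card_congr (β := Fin (growth X i p))]
      · exact Fintype.card_fin _
      · exact ⟨fun k => ⟨k.1, k.2⟩, fun k => ⟨⟨k, k.2.trans_le (growth_le i p)⟩, k.2⟩,
          fun _ => rfl, fun _ => rfl⟩
    exact (finrank_span_eq_card (hY.comp (fun k : {k : Fin d // (k : ℕ) < growth X i p} => k.1)
      Subtype.val_injective)).trans this

theorem isAdaptedBasis (hX : ∀ i m, SmoothAt (X i) m)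
    (htop : ∀ i, r ≤ i → ∀ m, flagAt X i m = ⊤) {p : M}
    (b : Module.Basis (Fin d) ℝ (TangentSpace (𝓡 d) p))
    (hb : ∀ i ≤ r, Submodule.span ℝ (b '' {k : Fin d | (k : ℕ) < growth X i p}) =
      flagAt X i p) :
    IsAdaptedBasis b (fun k => weight (growth X · p) k)
      (fun a : BracketIndex X r => iterBracket X a.1 a.2.1 p) (fun a => a.1) := by
  have hk : ∀ k : Fin d, (k : ℕ) < growth X r p := fun k => by
    rw [growth_eq htop le_rfl]; exact k.2
  have hset : ∀ j, {k : Fin d | weight (growth X · p) k ≤ j} =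
      {k : Fin d | (k : ℕ) < growth X j p} := fun j =>
    Set.ext fun k => weight_le_iff (growth_mono p) ⟨r, hk k⟩
  intro j
  rcases le_total j r with hj | hj
  · rw [hset, hb j hj, flagAt_eq_span hX hj]
  · have h1 : {k : Fin d | weight (growth X · p) k ≤ j} =
        {k : Fin d | (k : ℕ) < growth X r p} := by
      rw [hset]; ext k
      exact ⟨fun _ => hk k, fun h => lt_of_lt_of_le h (growth_mono p hj)⟩
    have h2 : {a : BracketIndex X r | (a.1 : ℕ) ≤ j} = {a | (a.1 : ℕ) ≤ r} := by
      ext a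
      have := a.1.2
      exact ⟨fun _ => Nat.lt_succ_iff.1 this, fun h => le_trans h hj⟩
    rw [h1, h2, hb r le_rfl, flagAt_eq_span hX le_rfl]

namespace FlagFrame

variable {n : ℕ → ℕ} {O : Set M} {Y : Fin d → VField d M}

theorem span_eq (hF : FlagFrame X n O Y) {p : M} (hp : p ∈ O) (i : ℕ) :
    Submodule.span ℝ ((fun k => Y k p) '' {k : Fin d | (k : ℕ) < n i}) = flagAt X i p := by
  rw [← hF.growth_eq p hp i]
  exact span_image_eq_flagAt (hF.isFrame.linearIndependent hp)
    fun k hk => apply_mem_flagAt (hF.mem_flag k i (hF.growth_eq p hp i ▸ hk)) p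

/-- An adapted frame made of fields in the flag. -/
def toAdaptedFrame (hF : FlagFrame X (growth X · m) O Y) (hm : m ∈ O)
    (horth : ∀ k l : Fin d, (k : ℕ) < growth X 0 m → (l : ℕ) < growth X 0 m →
        subRiemInner X m (Y k m) (Y l m) = if k = l then 1 else 0) : AdaptedFrame X r m where
  dom := O
  isOpen_dom := hF.isOpen
  mem_dom := hm
  Z := Y
  isFrame := hF.isFrame
  span_eq _ hp i _ := hF.span_eq hp i
  orthonormal := horth

end FlagFrame

end Frames

/-! ### Iterated brackets modulo the lower flag are tensorial -/

section Tensoriality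

open VectorField

variable {d : ℕ} {M : Type*} [TopologicalSpace M] [ChartedSpace (EuclideanSpace ℝ (Fin d)) M]
  {N₀ : ℕ} {X : Fin N₀ → VField d M} {r : ℕ} {m : M} [IsManifold (𝓡 d) ∞ M]

theorem mlieBracket_sub_sum_smul {ι : Type*} [Fintype ι] (c : ι → ℝ) {U A : VField d M}
    {W : ι → VField d M} (hA : SmoothAt A m) (hW : ∀ k, SmoothAt (W k) m) :
    mlieBracket (𝓡 d) U (A - ∑ k, c k • W k) m =
      mlieBracket (𝓡 d) U A m - ∑ k, c k • mlieBracket (𝓡 d) U (W k) m := by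
  have h1 := mlieBracket_sum_smul (U := U) (m := m) (Finset.univ : Finset ι)
    (f := fun k _ => -c k) (fun k _ => mdifferentiableAt_const) (fun k _ => hW k)
  have h2 : A - ∑ k, c k • W k = A + ∑ k, (fun _ : M => -c k) • W k := by
    rw [sub_eq_add_neg, ← Finset.sum_neg_distrib]
    congr 1
    refine Finset.sum_congr rfl fun k _ => ?_
    funext p
    simp
  have h3 : SmoothAt (∑ k, (fun _ : M => -c k) • W k) m := by
    refine SmoothAt.sum fun k _ => ?_
    exact (hW k).const_smul (-c k)
  rw [h2, mlieBracket_add_right hA.mdifferentiableAt h3.mdifferentiableAt, h1]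
  simp [mvfderiv, mfderiv_const, sub_eq_add_neg]

/-- `W` is a smooth section of `𝒟_i` over `O`. -/
structure IsSectionOn (X : Fin N₀ → VField d M) (i : ℕ) (O : Set M) (W : VField d M) : Prop where
  smoothAt : ∀ p ∈ O, SmoothAt W p
  mem : ∀ p ∈ O, W p ∈ flagAt X i p

namespace IsSectionOn

variable {i : ℕ} {O : Set M} {V W : VField d M}

theorem of_mem_flag (hX : ∀ i m, SmoothAt (X i) m) (hW : W ∈ flag X i) : IsSectionOn X i O W :=
  ⟨fun p _ => smoothAt_of_mem_flag hX hW p, fun p _ => apply_mem_flagAt hW p⟩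

theorem sub (hV : IsSectionOn X i O V) (hW : IsSectionOn X i O W) : IsSectionOn X i O (V - W) :=
  ⟨fun p hp => (hV.smoothAt p hp).sub (hW.smoothAt p hp),
    fun p hp => Submodule.sub_mem _ (hV.mem p hp) (hW.mem p hp)⟩

theorem sum_smul {ι : Type*} {s : Finset ι} {W : ι → VField d M} (c : ι → ℝ)
    (hW : ∀ k ∈ s, IsSectionOn X i O (W k)) : IsSectionOn X i O (∑ k ∈ s, c k • W k) := by
  refine ⟨fun p hp => SmoothAt.sum fun k hk => ((hW k hk).smoothAt p hp).const_smul _,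
    fun p hp => ?_⟩
  rw [Finset.sum_apply]
  exact Submodule.sum_mem _ fun k hk => Submodule.smul_mem _ _ ((hW k hk).mem p hp)

end IsSectionOn

/-- `𝒟_{i-1}(m)`, with `𝒟_{-1} = 0`. -/
noncomputable def prevFlagAt (X : Fin N₀ → VField d M) : ℕ → (m : M) → Submodule ℝ (TangentSpace (𝓡 d) m)
  | 0, _ => ⊥
  | i + 1, m => flagAt X i m

namespace FlagFrame

variable {n : ℕ → ℕ} {O : Set M} {Y : Fin d → VField d M} {U V W : VField d M} {p : M} {i : ℕ}

theorem coeff_eq_zero (hF : FlagFrame X n O Y) (hp : p ∈ O) {v : VField d M}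
    (hv : v p ∈ flagAt X i p) {k : Fin d} (hk : ¬ (k : ℕ) < n i) :
    hF.isFrame.coeff k p (v p) = 0 := by
  rw [hF.isFrame.coeff_apply_of_mem hp]
  refine repr_eq_zero_of_mem_span (s := {k : Fin d | (k : ℕ) < n i}) ?_ hk
  rw [← hF.span_eq hp i] at hv
  have : (hF.isFrame.toBasisAt hp : Fin d → TangentSpace (𝓡 d) p) = fun k => Y k p :=
    funext fun k => hF.isFrame.toBasisAt_coe hp k
  rwa [this]

/-- The bracket with a section of `𝒟_i`, expanded in the frame. -/
theorem mlieBracket_eq (hF : FlagFrame X n O Y) (hX : ∀ i m, SmoothAt (X i) m) (hp : p ∈ O)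
    (hW : IsSectionOn X i O W) :
    ∃ a : Fin d → ℝ, mlieBracket (𝓡 d) U W p =
      ∑ k ∈ Finset.univ.filter (fun k : Fin d => (k : ℕ) < n i),
        (a k • Y k p + hF.isFrame.coeff k p (W p) • mlieBracket (𝓡 d) U (Y k) p) := by
  let f : Fin d → M → ℝ := fun k q => hF.isFrame.coeff k q (W q)
  -- Near `p` the section is a combination of the first n_i frame fields with smooth coefficients.
  -- The Leibniz rule then leaves derivative terms inside 𝒟_i and brackets weighted by the values of
  -- the coefficients at `p`.
  have hWf : W =ᶠ[𝓝 p] (∑ k ∈ Finset.univ.filter (fun k : Fin d => (k : ℕ) < n i), f k • Y k :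
      VField d M) := by
    filter_upwards [hF.isOpen.mem_nhds hp] with q hq
    rw [hF.isFrame.coeff_sum_eq W hq, Finset.sum_apply, Finset.sum_filter]
    refine Finset.sum_congr rfl fun k _ => ?_
    split_ifs with hk
    · rfl
    · rw [hF.coeff_eq_zero hq (hW.mem q hq) hk, zero_smul]
  refine ⟨fun k => mvfderiv (𝓡 d) (f k) p (U p), ?_⟩
  rw [EventuallyEq.rfl.mlieBracket_vectorField_eq hWf, mlieBracket_sum_smul]
  · intro k _
    exact (contMDiffAt_coeff hF.isOpen hF.isFrame hp (hW.smoothAt p hp) k).mdifferentiableAt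
      (by simp)
  · exact fun k hk => smoothAt_of_mem_flag hX (hF.mem_flag k i (Finset.mem_filter.1 hk).2) p

variable (hF : FlagFrame X n O Y) (hX : ∀ i m, SmoothAt (X i) m) (hp : p ∈ O)
include hF hX hp

omit hX hp in
theorem frame_mem_flagAt {k : Fin d} (hk : (k : ℕ) < n i) (p : M) : Y k p ∈ flagAt X i p :=
  apply_mem_flagAt (hF.mem_flag k i hk) p

/-- A section of 𝒟₀ is a combination of flag fields with function coefficients, hence need not
belong to `flag X 0`, and the definition of the flag does not apply to its brackets. Expanding it in
the frame costs only derivative terms, which stay in 𝒟₀. -/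
theorem mlieBracket_mem_of_mem_flag (hU : IsSectionOn X 0 O U) (hV : V ∈ flag X i) :
    mlieBracket (𝓡 d) U V p ∈ flagAt X (i + 1) p := by
  obtain ⟨a, ha⟩ := hF.mlieBracket_eq hX hp hU (U := V)
  rw [mlieBracket_swap_apply, ha]
  refine Submodule.neg_mem _ (Submodule.sum_mem _ fun k hk => Submodule.add_mem _
    (Submodule.smul_mem _ _ ?_) (Submodule.smul_mem _ _ ?_))
  · exact flagAt_mono p (Nat.zero_le _) (hF.frame_mem_flagAt (Finset.mem_filter.1 hk).2 p)
  · rw [mlieBracket_swap_apply]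
    exact Submodule.neg_mem _ (apply_mem_flagAt
      (mlieBracket_mem_flag (hF.mem_flag k 0 (Finset.mem_filter.1 hk).2) hV) p)

theorem mlieBracket_mem (hU : IsSectionOn X 0 O U) (hW : IsSectionOn X i O W) :
    mlieBracket (𝓡 d) U W p ∈ flagAt X (i + 1) p := by
  obtain ⟨a, ha⟩ := hF.mlieBracket_eq hX hp hW (U := U)
  rw [ha]
  refine Submodule.sum_mem _ fun k hk => Submodule.add_mem _
    (Submodule.smul_mem _ _ ?_) (Submodule.smul_mem _ _ ?_)
  · exact flagAt_mono p i.le_succ (hF.frame_mem_flagAt (Finset.mem_filter.1 hk).2 p)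
  · exact hF.mlieBracket_mem_of_mem_flag hX hp hU (hF.mem_flag k i (Finset.mem_filter.1 hk).2)

/-- Modulo `𝒟_i(p)`, the bracket of sections of `𝒟₀` and `𝒟_i` is tensorial on the left. -/
theorem mlieBracket_mem_of_eq_zero (hU : IsSectionOn X 0 O U) (hU0 : U p = 0) :
    mlieBracket (𝓡 d) U W p ∈ flagAt X i p := by
  obtain ⟨a, ha⟩ := hF.mlieBracket_eq hX hp hU (U := W)
  rw [mlieBracket_swap_apply, ha]
  refine Submodule.neg_mem _ (Submodule.sum_mem _ fun k hk => Submodule.add_mem _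
    (Submodule.smul_mem _ _ ?_) ?_)
  · exact flagAt_mono p (Nat.zero_le _) (hF.frame_mem_flagAt (Finset.mem_filter.1 hk).2 p)
  -- The coefficients of `U` vanish at `p`, so only their derivatives survive, and these terms lie
  -- in 𝒟₀.
  · rw [hU0, map_zero, zero_smul]
    exact Submodule.zero_mem _

/-- Modulo `𝒟_i(p)`, the bracket of sections of `𝒟₀` and `𝒟_i` only depends on the second section
at `p` modulo `𝒟_{i-1}(p)`. -/
theorem mlieBracket_mem_of_mem_prev (hU : IsSectionOn X 0 O U) (hW : IsSectionOn X i O W)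
    (hW0 : W p ∈ prevFlagAt X i p) : mlieBracket (𝓡 d) U W p ∈ flagAt X i p := by
  obtain ⟨a, ha⟩ := hF.mlieBracket_eq hX hp hW (U := U)
  rw [ha]
  refine Submodule.sum_mem _ fun k hk => Submodule.add_mem _
    (Submodule.smul_mem _ _ (hF.frame_mem_flagAt (Finset.mem_filter.1 hk).2 p)) ?_
  cases i with
  | zero =>
    rw [show W p = 0 from hW0, map_zero, zero_smul]
    exact Submodule.zero_mem _
  | succ i =>
    -- Frame fields from the lower step of the flag have brackets one level up, which is still
    -- allowed; the coefficients of the remaining ones vanish at `p`.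
    by_cases hki : (k : ℕ) < n i
    · exact Submodule.smul_mem _ _
        (hF.mlieBracket_mem_of_mem_flag hX hp hU (hF.mem_flag k i hki))
    · rw [hF.coeff_eq_zero hp hW0 hki, zero_smul]
      exact Submodule.zero_mem _

omit hp in
theorem isSectionOn_iterBracket {ι : Type*} {Z : ι → VField d M}
    (hZ : ∀ k, IsSectionOn X 0 O (Z k)) (j : ℕ) (K : Fin (j + 1) → ι) :
    IsSectionOn X j O (iterBracket Z j K) := by
  induction j with
  | zero => exact hZ _
  | succ j ih =>
    exact ⟨fun p hp => ((hZ _).smoothAt p hp).mlieBracket ((ih _).smoothAt p hp),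
      fun p hp => hF.mlieBracket_mem hX hp (hZ _) (ih _)⟩

/-- The top order part of an iterated bracket is multilinear in the values of the fields. -/
theorem iterBracket_sub_mem {ι : Type*} [Fintype ι] {Z : ι → VField d M}
    (hZ : ∀ k, IsSectionOn X 0 O (Z k)) {c : Fin N₀ → ι → ℝ}
    (hc : ∀ i, X i p = ∑ k, c i k • Z k p) (j : ℕ) (I : Fin (j + 1) → Fin N₀) :
    iterBracket X j I p - ∑ K : Fin (j + 1) → ι, (∏ s, c (I s) (K s)) • iterBracket Z j K p ∈
      prevFlagAt X j p := by
  have hXs : ∀ i, IsSectionOn X 0 O (X i) := fun i =>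
    .of_mem_flag hX (Submodule.subset_span ⟨i, rfl⟩)
  induction j with
  | zero =>
    have : iterBracket X 0 I p -
        ∑ K : Fin (0 + 1) → ι, (∏ s, c (I s) (K s)) • iterBracket Z 0 K p = 0 := by
      rw [sub_eq_zero, ← (Equiv.funUnique (Fin 1) ι).symm.sum_comp]
      simpa [iterBracket] using hc (I 0)
    rw [this]
    exact Submodule.zero_mem _
  | succ j ih =>
    set I' : Fin (j + 1) → Fin N₀ := Fin.tail I
    set W := iterBracket X j I'
    have hWs : IsSectionOn X j O W := hF.isSectionOn_iterBracket hX hXs j I'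
    have hZs : ∀ K, IsSectionOn X j O (iterBracket Z j K) := hF.isSectionOn_iterBracket hX hZ j
    -- The outer field is replaced first: with the coefficients frozen at `p`, the difference of the
    -- two fields is a section of 𝒟₀ vanishing at `p`.
    have h1 : mlieBracket (𝓡 d) (X (I 0)) W p -
        ∑ k, c (I 0) k • mlieBracket (𝓡 d) (Z k) W p ∈ flagAt X j p := by
      have h := hF.mlieBracket_mem_of_eq_zero hX hp
        ((hXs (I 0)).sub (.sum_smul (s := Finset.univ) (c (I 0)) fun k _ => hZ k))
        (i := j) (W := W) (by simp [hc])
      rw [mlieBracket_swap_apply, mlieBracket_sub_sum_smul _ ((hXs (I 0)).smoothAt p hp)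
        fun k => (hZ k).smoothAt p hp] at h
      rw [mlieBracket_swap_apply]
      simp only [mlieBracket_swap_apply (V := Z _), smul_neg, Finset.sum_neg_distrib]
      convert h using 1
      abel
    -- Then the inner bracket: by induction the error has its value at `p` one step lower in the
    -- flag.
    have h2 : ∀ k, mlieBracket (𝓡 d) (Z k) W p -
        ∑ K : Fin (j + 1) → ι, (∏ s, c (I' s) (K s)) •
          mlieBracket (𝓡 d) (Z k) (iterBracket Z j K) p ∈ flagAt X j p := by
      intro k
      have h := hF.mlieBracket_mem_of_mem_prev hX hp (hZ k) (hWs.sub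
        (.sum_smul (s := Finset.univ) (fun K : Fin (j + 1) → ι => ∏ s, c (I' s) (K s))
          fun K _ => hZs K))
        (by simpa using ih I')
      rwa [mlieBracket_sub_sum_smul _ (hWs.smoothAt p hp) fun K => (hZs K).smoothAt p hp] at h
    have h3 : ∑ K : Fin (j + 1 + 1) → ι, (∏ s, c (I s) (K s)) • iterBracket Z (j + 1) K p =
        ∑ k, c (I 0) k • ∑ K : Fin (j + 1) → ι, (∏ s, c (I' s) (K s)) •
          mlieBracket (𝓡 d) (Z k) (iterBracket Z j K) p := by
      rw [← (Fin.consEquiv fun _ => ι).sum_comp, Fintype.sum_prod_type]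
      refine Finset.sum_congr rfl fun k _ => ?_
      rw [Finset.smul_sum]
      refine Finset.sum_congr rfl fun K _ => ?_
      rw [Fin.prod_univ_succ, smul_smul]
      rfl
    have h4 := Submodule.add_mem _ h1 (Submodule.sum_mem _ fun k (_ : k ∈ Finset.univ) =>
      Submodule.smul_mem _ (c (I 0) k) (h2 k))
    rw [h3]
    simp only [smul_sub, Finset.sum_sub_distrib] at h4
    simpa [prevFlagAt, iterBracket] using h4

end FlagFrame

end Tensoriality

/-! ### The rescaled volume and its limit at a point -/

section PointwiseLimit

open Matrix

variable {d : ℕ} {M : Type*} [TopologicalSpace M] [ChartedSpace (EuclideanSpace ℝ (Fin d)) M]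
  {N₀ : ℕ} {X : Fin N₀ → VField d M} {r : ℕ} {m : M}

/-- The determinant of the Gram matrix of the rescaled bracket fields, in the basis `b`. -/
noncomputable def gramDet (X : Fin N₀ → VField d M) (r : ℕ) (w : Fin d → ℕ)
    (b : Module.Basis (Fin d) ℝ (TangentSpace (𝓡 d) m)) (h : ℝ) : ℝ :=
  (scaledCoord b w (fun a : BracketIndex X r => iterBracket X a.1 a.2.1 m) (fun a => a.1) h *
    (scaledCoord b w (fun a : BracketIndex X r => iterBracket X a.1 a.2.1 m)
      (fun a => a.1) h)ᵀ).det

theorem continuous_gramDet (w : Fin d → ℕ)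
    (b : Module.Basis (Fin d) ℝ (TangentSpace (𝓡 d) m)) : Continuous (gramDet X r w b) := by
  have : Continuous fun h : ℝ => scaledCoord b w
      (fun a : BracketIndex X r => iterBracket X a.1 a.2.1 m) (fun a => a.1) h :=
    continuous_matrix fun k a => (continuous_pow _).mul continuous_const
  exact (this.matrix_mul this.matrix_transpose).matrix_det

variable {w : Fin d → ℕ} {b : Module.Basis (Fin d) ℝ (TangentSpace (𝓡 d) m)}

/-- The dilation of the tangent space has determinant h^{-∑ w}, which the prefactor cancels. What
remains on the right makes sense at h = 0 as well. -/
theorem approxVol_eq (hb : IsAdaptedBasis b w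
      (fun a : BracketIndex X r => iterBracket X a.1 a.2.1 m) (fun a => a.1)) {h : ℝ} (hh : 0 < h)
    (v : Fin d → TangentSpace (𝓡 d) m) :
    h ^ (∑ k, w k) * approxVol X r h m v = |b.det v| * (√(gramDet X r w b h))⁻¹ := by
  set A := scaledCoord b w (fun a : BracketIndex X r => iterBracket X a.1 a.2.1 m)
    (fun a => a.1) h
  have hmet : ∀ v, approxMetric X r h m v = (fun k => (h ^ w k)⁻¹ * b.repr v k) ⬝ᵥ
        ((A * Aᵀ)⁻¹ *ᵥ fun k => (h ^ w k)⁻¹ * b.repr v k) := fun v =>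
    (hb.isLeast hh.ne' v).csInf_eq
  have hin : ∀ v v', approxInner X r h m v v' = (fun k => (h ^ w k)⁻¹ * b.repr v k) ⬝ᵥ
        ((A * Aᵀ)⁻¹ *ᵥ fun k => (h ^ w k)⁻¹ * b.repr v' k) := by
    intro v v'
    have hadd : (fun k => (h ^ w k)⁻¹ * b.repr (v + v') k) =
        (fun k => (h ^ w k)⁻¹ * b.repr v k) + fun k => (h ^ w k)⁻¹ * b.repr v' k := by
      funext k; simp [mul_add]
    rw [approxInner, hmet, hmet, hmet, hadd, polarization _ (transpose_inv_mul_transpose A)]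
  have hvol : approxVol X r h m v = |∏ k, (h ^ w k)⁻¹| * |b.det v| * (√(A * Aᵀ).det)⁻¹ := by
    rw [approxVol]
    simp only [hin]
    exact sqrt_abs_det_gram (hb.det_pos h) b _ v
  have hprod : |∏ k, (h ^ w k)⁻¹| = (h ^ (∑ k, w k))⁻¹ := by
    rw [Finset.prod_inv_distrib, Finset.prod_pow_eq_pow_sum, abs_of_pos (by positivity)]
  rw [hvol, hprod, mul_assoc, mul_inv_cancel_left₀ (by positivity)]
  rfl

theorem iterBracket_comp {ι κ : Type*} (Z : κ → VField d M) (φ : ι → κ) (j : ℕ)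
    (K : Fin (j + 1) → ι) :
    iterBracket Z j (fun s => φ (K s)) = iterBracket (fun k => Z (φ k)) j K := by
  induction j with
  | zero => rfl
  | succ j ih =>
    simp only [iterBracket, ← ih]
    rfl

variable [IsManifold (𝓡 d) ∞ M]

theorem FlagFrame.mono {n : ℕ → ℕ} {O O' : Set M} {Y : Fin d → VField d M}
    (hF : FlagFrame X n O Y) (hO' : IsOpen O') (h : O' ⊆ O) : FlagFrame X n O' Y :=
  ⟨hO', hF.isFrame.mono h, hF.mem_flag, fun p hp => hF.growth_eq p (h hp)⟩

namespace AdaptedFrame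

variable (F : AdaptedFrame X r m)

theorem basis_apply (k : Fin d) : F.basis k = F.Z k m := F.isFrame.toBasisAt_coe F.mem_dom k

theorem span_basis {i : ℕ} (hi : i ≤ r) :
    Submodule.span ℝ (F.basis '' {k : Fin d | (k : ℕ) < growth X i m}) = flagAt X i m := by
  rw [← F.span_eq m F.mem_dom i hi]
  congr 2
  exact funext F.basis_apply

/-- The coordinates of a top order bracket of the given fields, in terms of the structure
constants of the frame. -/
theorem repr_iterBracket (hX : ∀ i m, SmoothAt (X i) m)
    (htop : ∀ i, r ≤ i → ∀ m, flagAt X i m = ⊤) (hm : m ∈ equiregularRegion X r) {j : ℕ}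
    (hj : j ≤ r) (I : Fin (j + 1) → Fin N₀) {l : Fin d} (hl : prevGrowth X j m ≤ l) :
    F.basis.repr (iterBracket X j I m) l =
      ∑ K : Fin (j + 1) → {k : Fin d // (k : ℕ) < growth X 0 m},
        (∏ s, F.basis.repr (X (I s) m) (K s)) * F.structConst j K l := by
  -- The fields of `F` are only pointwise sections of the flag. The auxiliary frame `Y` of genuine
  -- flag fields, otherwise unrelated to `F`, is what makes the tensoriality lemmas applicable.
  obtain ⟨O, Y, hY, hmO, -⟩ := exists_flagFrame hX htop hm
  have hY' := hY.mono (hY.isOpen.inter F.isOpen_dom) Set.inter_subset_left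
  have hZ : ∀ k : {k : Fin d // (k : ℕ) < growth X 0 m},
      IsSectionOn X 0 (O ∩ F.dom) (F.Z k.1) := fun k =>
    ⟨fun p hp => F.isFrame.contMDiffAt F.isOpen_dom hp.2 k.1, fun p hp => by
      rw [← F.span_eq p hp.2 0 (Nat.zero_le r)]
      exact Submodule.subset_span ⟨k.1, k.2, rfl⟩⟩
  have hc : ∀ i, X i m = ∑ k : {k : Fin d // (k : ℕ) < growth X 0 m},
      F.basis.repr (X i m) k • F.Z k.1 m := by
    intro i
    have hXi : X i m ∈ flagAt X 0 m := apply_mem_flagAt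
      (show X i ∈ flag X 0 from Submodule.subset_span ⟨i, rfl⟩) m
    have h := F.basis.sum_repr (X i m)
    rw [← Fintype.sum_subtype_add_sum_subtype (fun k : Fin d => (k : ℕ) < growth X 0 m),
      Finset.sum_eq_zero (s := Finset.univ (α := {k : Fin d // ¬ (k : ℕ) < growth X 0 m})),
      add_zero] at h
    · simp only [F.basis_apply] at h
      exact h.symm
    · rintro k -
      rw [repr_eq_zero_of_mem_span (s := {k : Fin d | (k : ℕ) < growth X 0 m})
        (by rw [F.span_basis (Nat.zero_le r)]; exact hXi) k.2, zero_smul]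
  have key := hY'.iterBracket_sub_mem hX ⟨hmO, F.mem_dom⟩ hZ hc j I
  have hprev : ∀ v ∈ prevFlagAt X j m, F.basis.repr v l = 0 := by
    intro v hv
    cases j with
    | zero => rw [show v = 0 from hv]; simp
    | succ j =>
      refine repr_eq_zero_of_mem_span (s := {k : Fin d | (k : ℕ) < growth X j m}) ?_ (not_lt.2 hl)
      rw [F.span_basis (by omega)]
      exact hv
  have h0 := hprev _ key
  rw [map_sub, Finsupp.sub_apply, sub_eq_zero] at h0
  rw [h0, map_sum, Finsupp.coe_finsetSum, Finset.sum_apply]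
  simp only [map_smul, Finsupp.smul_apply, smul_eq_mul]
  refine Finset.sum_congr rfl fun K _ => ?_
  rw [structConst, ← iterBracket_comp F.Z fun k : {k : Fin d // (k : ℕ) < growth X 0 m} => k.1]

/-- The blocks of the Gram matrix of the given fields coincide with the matrices `B_j`. -/
theorem sum_repr_mul_repr (hX : ∀ i m, SmoothAt (X i) m)
    (htop : ∀ i, r ≤ i → ∀ m, flagAt X i m = ⊤) (hm : m ∈ equiregularRegion X r) {j : ℕ}
    (hj : j ≤ r) {k l : Fin d} (hk : prevGrowth X j m ≤ k) (hl : prevGrowth X j m ≤ l) :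
    ∑ I : Fin (j + 1) → Fin N₀,
        F.basis.repr (iterBracket X j I m) k * F.basis.repr (iterBracket X j I m) l =
      ∑ K, F.structConst j K k * F.structConst j K l := by
  have horth : ∀ k l : {k : Fin d // (k : ℕ) < growth X 0 m},
      ∑ i, F.basis.repr (X i m) k * F.basis.repr (X i m) l = if k = l then 1 else 0 := by
    intro k l
    rw [sum_repr_mul_repr_of_orthonormal (x := fun i => X i m) (n := growth X 0 m) ?_ ?_ k.2 l.2]
    · simp [Subtype.ext_iff]
    · rw [F.span_basis (Nat.zero_le r), flagAt, flag, Submodule.map_span, ← Set.range_comp]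
      rfl
    · intro k l hk hl
      rw [F.basis_apply, F.basis_apply]
      exact F.orthonormal k l hk hl
  -- The sum over multi-indices factors into one sum per slot, each of which is an orthonormality
  -- relation.
  have hdelta : ∀ K L : Fin (j + 1) → {k : Fin d // (k : ℕ) < growth X 0 m},
      ∑ I : Fin (j + 1) → Fin N₀, (∏ s, F.basis.repr (X (I s) m) (K s)) *
        (∏ s, F.basis.repr (X (I s) m) (L s)) = if K = L then 1 else 0 := by
    intro K L
    simp only [← Finset.prod_mul_distrib]
    have := Finset.prod_univ_sum (fun _ : Fin (j + 1) => (Finset.univ : Finset (Fin N₀)))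
      (fun s i => F.basis.repr (X i m) (K s) * F.basis.repr (X i m) (L s))
    rw [Fintype.piFinset_univ] at this
    rw [← this]
    simp only [horth]
    split_ifs with hKL
    · subst hKL; simp
    · obtain ⟨s, hs⟩ := Function.ne_iff.1 hKL
      exact Finset.prod_eq_zero (Finset.mem_univ s) (if_neg hs)
  simp only [F.repr_iterBracket hX htop hm hj _ hk, F.repr_iterBracket hX htop hm hj _ hl,
    Finset.sum_mul_sum]
  rw [Finset.sum_comm]
  refine Finset.sum_congr rfl fun K _ => ?_
  rw [Finset.sum_comm]
  calc _ = ∑ L, (∑ I : Fin (j + 1) → Fin N₀, (∏ s, F.basis.repr (X (I s) m) (K s)) *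
        (∏ s, F.basis.repr (X (I s) m) (L s))) * (F.structConst j K k * F.structConst j L l) := by
        refine Finset.sum_congr rfl fun L _ => ?_
        rw [Finset.sum_mul]
        exact Finset.sum_congr rfl fun I _ => by ring
    _ = _ := by simp [hdelta]

-- Brackets that vanish identically are left out of the index type; adding them back changes nothing
-- since `g 0 = 0`.
omit [IsManifold (𝓡 d) ∞ M] in
theorem _root_.SubRiem.sum_bracketIndex {j : ℕ} (hj : j ≤ r) (g : TangentSpace (𝓡 d) m → ℝ)
    (hg : g 0 = 0) :
    ∑ a : BracketIndex X r with (a.1 : ℕ) = j, g (iterBracket X a.1 a.2.1 m) =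
      ∑ I : Fin (j + 1) → Fin N₀, g (iterBracket X j I m) := by
  classical
  rw [← Finset.sum_filter_of_ne (p := IsBracketIndex X j)]
  · symm
    refine Finset.sum_bij (fun I h => (⟨⟨j, Nat.lt_succ_of_le hj⟩, I, (Finset.mem_filter.1 h).2⟩ :
      BracketIndex X r)) ?_ ?_ ?_ ?_
    · intro I h; simp
    · intro I h I' h' heq
      simpa using heq
    · rintro ⟨⟨i, hi⟩, I, hI⟩ ha
      obtain rfl : i = j := (Finset.mem_filter.1 ha).2
      exact ⟨I, Finset.mem_filter.2 ⟨Finset.mem_univ _, hI⟩, rfl⟩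
    · intro I h; rfl
  · intro I _ h
    by_contra hI
    simp only [IsBracketIndex, not_or, not_exists, not_not] at hI
    exact h (by rw [hI.2 m, hg])

theorem isAdaptedBasis (hX : ∀ i m, SmoothAt (X i) m)
    (htop : ∀ i, r ≤ i → ∀ m, flagAt X i m = ⊤) :
    IsAdaptedBasis F.basis (fun k => weight (growth X · m) k)
      (fun a : BracketIndex X r => iterBracket X a.1 a.2.1 m) (fun a => a.1) :=
  SubRiem.isAdaptedBasis hX htop F.basis fun _ hi => F.span_basis hi

/-- The determinant splits over the blocks of equal weight, and the indices of weight j are those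
with n_{j-1} ≤ k < n_j, which index B_j. -/
theorem gramDet_zero (hX : ∀ i m, SmoothAt (X i) m)
    (htop : ∀ i, r ≤ i → ∀ m, flagAt X i m = ⊤) (hm : m ∈ equiregularRegion X r) :
    gramDet X r (fun k => weight (growth X · m) k) F.basis 0 =
      ∏ j ∈ Finset.range (r + 1), (F.B j).det := by
  have hk : ∀ k : Fin d, (k : ℕ) < growth X r m := fun k => by
    rw [growth_eq htop le_rfl]; exact k.2
  have hb := F.isAdaptedBasis hX htop
  rw [gramDet, det_eq_prod_blocks _ (fun k : Fin d => weight (growth X · m) k) r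
    (fun k => (weight_le_iff (growth_mono m) ⟨r, hk k⟩).2 (hk k))
    (fun k l hkl => by rw [scaledCoord_zero_gram_apply hb, if_neg hkl])]
  refine Finset.prod_congr rfl fun j hj => ?_
  have hj' : j ≤ r := Nat.lt_succ_iff.1 (Finset.mem_range.1 hj)
  let e : {k : Fin d // weight (growth X · m) k = j} ≃
      {l : Fin d // prevGrowth X j m ≤ (l : ℕ) ∧ (l : ℕ) < growth X j m} :=
    Equiv.subtypeEquivRight fun k => weight_growth_eq_iff ⟨r, hk k⟩
  rw [← Matrix.det_submatrix_equiv_self e]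
  congr 1
  ext k l
  have hkl : weight (growth X · m) k.1 = weight (growth X · m) l.1 := k.2.trans l.2.symm
  rw [toSquareBlock_def, of_apply, scaledCoord_zero_gram_apply hb, if_pos hkl, k.2,
    sum_bracketIndex hj' (fun v => F.basis.repr v k * F.basis.repr v l) (by simp),
    F.sum_repr_mul_repr hX htop hm hj' (k := k) (l := l) (e k).2.1 (e l).2.1]
  rfl

/-- The rescaled Riemannian volumes converge to Popp's volume in every adapted frame. -/
theorem tendsto_approxVol (hX : ∀ i m, SmoothAt (X i) m)
    (htop : ∀ i, r ≤ i → ∀ m, flagAt X i m = ⊤) (hm : m ∈ equiregularRegion X r)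
    (v : Fin d → TangentSpace (𝓡 d) m) :
    Tendsto (fun h : ℝ => h ^ (homDim X r m - d) * approxVol X r h m v) (𝓝[>] 0)
      (𝓝 (F.poppFormula v)) := by
  have hb := F.isAdaptedBasis hX htop
  have hlim : Tendsto (fun h => |F.basis.det v| *
      (√(gramDet X r (fun k => weight (growth X · m) k) F.basis h))⁻¹) (𝓝[>] 0)
      (𝓝 (|F.basis.det v| *
        (√(gramDet X r (fun k => weight (growth X · m) k) F.basis 0))⁻¹)) := by
    -- Positivity of the Gram determinant at h = 0 keeps the limit finite.
    refine Tendsto.const_mul _ (Tendsto.inv₀ ?_ (Real.sqrt_pos.2 (hb.det_pos 0)).ne')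
    exact ((continuous_gramDet _ _).sqrt.tendsto 0).mono_left nhdsWithin_le_nhds
  rw [F.gramDet_zero hX htop hm, mul_comm] at hlim
  refine hlim.congr' ?_
  filter_upwards [self_mem_nhdsWithin] with h hh
  rw [← approxVol_eq hb hh v, ← sum_weight_eq htop m, zpow_natCast]

end AdaptedFrame

end PointwiseLimit

/-! ### Frame independence, uniform convergence and the induced volume -/

section UniformLimit

variable {d : ℕ} {M : Type*} [TopologicalSpace M] [ChartedSpace (EuclideanSpace ℝ (Fin d)) M]
  {N₀ : ℕ} {X : Fin N₀ → VField d M} {r : ℕ} {m : M} [IsManifold (𝓡 d) ∞ M]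

theorem nonempty_adaptedFrame (hX : ∀ i m, SmoothAt (X i) m)
    (htop : ∀ i, r ≤ i → ∀ m, flagAt X i m = ⊤) (hm : m ∈ equiregularRegion X r) :
    Nonempty (AdaptedFrame X r m) := by
  obtain ⟨O, Y, hF, hmO, horth⟩ := exists_flagFrame hX htop hm
  exact ⟨hF.toAdaptedFrame hmO horth⟩

theorem tendsto_poppVol (hX : ∀ i m, SmoothAt (X i) m)
    (htop : ∀ i, r ≤ i → ∀ m, flagAt X i m = ⊤) (hm : m ∈ equiregularRegion X r)
    (v : Fin d → TangentSpace (𝓡 d) m) :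
    Tendsto (fun h : ℝ => h ^ (homDim X r m - d) * approxVol X r h m v) (𝓝[>] 0)
      (𝓝 (poppVol X r m v)) := by
  have hne := nonempty_adaptedFrame hX htop hm
  rw [poppVol, dif_pos hne]
  exact hne.some.tendsto_approxVol hX htop hm v

/-- Each adapted frame computes the limit of one and the same frame-free quantity, so no change of
frame needs to be worked out. -/
theorem poppVol_eq (hX : ∀ i m, SmoothAt (X i) m)
    (htop : ∀ i, r ≤ i → ∀ m, flagAt X i m = ⊤) (hm : m ∈ equiregularRegion X r)
    (F : AdaptedFrame X r m) : poppVol X r m = F.poppFormula :=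
  funext fun v => tendsto_nhds_unique (tendsto_poppVol hX htop hm v)
    (F.tendsto_approxVol hX htop hm v)

/-- The determinant of vectors at `p` in a local frame. -/
noncomputable def frameDet {O : Set M} {Y : Fin d → VField d M}
    (hY : IsLocalFrameOn (𝓡 d) (EuclideanSpace ℝ (Fin d)) ∞ Y O) (p : M)
    (v : Fin d → TangentSpace (𝓡 d) p) : ℝ :=
  (Matrix.of fun i j => hY.coeff i p (v j)).det

theorem frameDet_eq {O : Set M} {Y : Fin d → VField d M}
    (hY : IsLocalFrameOn (𝓡 d) (EuclideanSpace ℝ (Fin d)) ∞ Y O) {p : M} (hp : p ∈ O)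
    (v : Fin d → TangentSpace (𝓡 d) p) : frameDet hY p v = (hY.toBasisAt hp).det v := by
  rw [frameDet, Module.Basis.det_apply]
  congr 1
  ext i j
  simp [Module.Basis.toMatrix_apply, IsLocalFrameOn.coeff, hp]

theorem frameDet_ne_zero {O : Set M} {Y : Fin d → VField d M}
    (hY : IsLocalFrameOn (𝓡 d) (EuclideanSpace ℝ (Fin d)) ∞ Y O) {p : M} (hp : p ∈ O)
    (v : Module.Basis (Fin d) ℝ (TangentSpace (𝓡 d) p)) : frameDet hY p v ≠ 0 := by
  rw [frameDet_eq hY hp]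
  exact ((hY.toBasisAt hp).isUnit_det v).ne_zero

/-- Near an equiregular point, the rescaled volumes and Popp's volume are given by a common
formula, whose coefficient is continuous up to `h = 0`. -/
theorem exists_local_formula (hX : ∀ i m, SmoothAt (X i) m)
    (htop : ∀ i, r ≤ i → ∀ m, flagAt X i m = ⊤) {Q : ℤ}
    (hQ : ∀ m ∈ equiregularRegion X r, homDim X r m = Q) (hm : m ∈ equiregularRegion X r) :
    ∃ (O : Set M) (Y : Fin d → VField d M)
      (hY : IsLocalFrameOn (𝓡 d) (EuclideanSpace ℝ (Fin d)) ∞ Y O) (g : ℝ × M → ℝ),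
      IsOpen O ∧ m ∈ O ∧ ContinuousAt g (0, m) ∧
      (∀ h, ∀ p ∈ O, 0 < g (h, p)) ∧
      (∀ h > 0, ∀ p ∈ O, ∀ v, h ^ (Q - d) * approxVol X r h p v = |frameDet hY p v| * g (h, p)) ∧
      (∀ p ∈ O, ∀ v, poppVol X r p v = |frameDet hY p v| * g (0, p)) := by
  obtain ⟨O, Y, hF, hmO, -⟩ := exists_flagFrame hX htop hm
  have hO : ∀ p ∈ O, p ∈ equiregularRegion X r := fun p hp => by
    filter_upwards [hF.isOpen.mem_nhds hp] with q hq i _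
    rw [hF.growth_eq q hq, hF.growth_eq p hp]
  let hY := hF.isFrame
  let w : Fin d → ℕ := fun k => weight (growth X · m) k
  let A : ℝ × M → Matrix (Fin d) (BracketIndex X r) ℝ := fun q =>
    Matrix.of fun k a => q.1 ^ ((a.1 : ℕ) - w k) * hY.coeff k q.2 (iterBracket X a.1 a.2.1 q.2)
  have hA : ∀ h, ∀ p (hp : p ∈ O), (A (h, p) * (A (h, p)).transpose).det =
      gramDet X r w (hY.toBasisAt hp) h := by
    intro h p hp
    have : A (h, p) = scaledCoord (hY.toBasisAt hp) w
        (fun a : BracketIndex X r => iterBracket X a.1 a.2.1 p) (fun a => a.1) h := by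
      ext k a
      simp [A, scaledCoord, IsLocalFrameOn.coeff, hp]
    rw [this]
    rfl
  have hw : ∀ p ∈ O, (fun k : Fin d => weight (growth X · p) k) = w := fun p hp => by
    have : (growth X · p) = (growth X · m) := funext fun i => hF.growth_eq p hp i
    simp only [this, w]
  have hb : ∀ p (hp : p ∈ O), IsAdaptedBasis (hY.toBasisAt hp) w
      (fun a : BracketIndex X r => iterBracket X a.1 a.2.1 p) (fun a => a.1) := by
    intro p hp
    rw [← hw p hp]
    refine isAdaptedBasis hX htop _ fun i _ => ?_
    rw [hF.growth_eq p hp i, ← hF.span_eq hp i]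
    congr 2
    exact funext fun k => hY.toBasisAt_coe hp k
  have hpos : ∀ h, ∀ p ∈ O, 0 < (A (h, p) * (A (h, p)).transpose).det := fun h p hp => by
    rw [hA h p hp]; exact (hb p hp).det_pos h
  have hcont : ContinuousAt (fun q => (A q * (A q).transpose).det) (0, m) := by
    have h1 : ContinuousAt A (0, m) := by
      refine continuousAt_pi.2 fun k => continuousAt_pi.2 fun a => ?_
      refine ContinuousAt.mul (continuousAt_fst.pow _) ?_
      exact ContinuousAt.comp (f := Prod.snd) (x := ((0 : ℝ), m))
        (g := fun p => hY.coeff k p (iterBracket X a.1 a.2.1 p))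
        (contMDiffAt_coeff hF.isOpen hY hmO
          (smoothAt_of_mem_flag hX (iterBracket_mem_flag _ _) m) k).continuousAt continuousAt_snd
    have h2 : Continuous fun B : Matrix (Fin d) (BracketIndex X r) ℝ => (B * B.transpose).det :=
      (continuous_id.matrix_mul continuous_id.matrix_transpose).matrix_det
    exact h2.continuousAt.comp h1
  have hvol : ∀ h > 0, ∀ p ∈ O, ∀ v, h ^ (Q - d) * approxVol X r h p v =
      |frameDet hY p v| * (√(A (h, p) * (A (h, p)).transpose).det)⁻¹ := by
    intro h hh p hp v
    rw [hA h p hp, frameDet_eq hY hp, ← approxVol_eq (hb p hp) hh v, ← hQ p (hO p hp),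
      ← sum_weight_eq htop p, zpow_natCast, ← hw p hp]
  have hsqrt : ∀ h, ∀ p ∈ O, 0 < (√(A (h, p) * (A (h, p)).transpose).det)⁻¹ := fun h p hp =>
    inv_pos.2 (Real.sqrt_pos.2 (hpos h p hp))
  refine ⟨O, Y, hY, fun q => (√(A q * (A q).transpose).det)⁻¹, hF.isOpen, hmO,
    hcont.sqrt.inv₀ (Real.sqrt_pos.2 (hpos 0 m hmO)).ne', hsqrt, hvol, fun p hp v => ?_⟩
  -- `Y` is not orthonormal at the points `p`, so it cannot be inserted into Popp's formula there.
  -- The value is identified instead as the limit of the rescaled volumes.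
  refine tendsto_nhds_unique (tendsto_poppVol hX htop (hO p hp) v) ?_
  have hlim : Tendsto (fun h => |frameDet hY p v| *
      (√(A (h, p) * (A (h, p)).transpose).det)⁻¹) (𝓝[>] 0)
      (𝓝 (|frameDet hY p v| * (√(A (0, p) * (A (0, p)).transpose).det)⁻¹)) := by
    refine Tendsto.const_mul _ (Tendsto.inv₀ ?_ (Real.sqrt_pos.2 (hpos 0 p hp)).ne')
    simp only [hA _ p hp]
    exact ((continuous_gramDet _ _).sqrt.tendsto 0).mono_left nhdsWithin_le_nhds
  refine hlim.congr' ?_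
  filter_upwards [self_mem_nhdsWithin] with h hh
  rw [hQ p (hO p hp), hvol h hh p hp]

omit [ChartedSpace (EuclideanSpace ℝ (Fin d)) M] [IsManifold (𝓡 d) ∞ M] in
/-- Uniform convergence on a compact set, from joint convergence at its points. -/
theorem tendstoUniformlyOn_of_tendsto_prod {F : ℝ → M → ℝ} {f : M → ℝ} {l : Filter ℝ} {K : Set M}
    (hK : IsCompact K)
    (h : ∀ m ∈ K, ∃ a, Tendsto (fun q : ℝ × M => F q.1 q.2) (l ×ˢ 𝓝 m) (𝓝 a) ∧
      Tendsto f (𝓝 m) (𝓝 a)) : TendstoUniformlyOn F f l K := by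
  rw [← tendstoLocallyUniformlyOn_iff_tendstoUniformlyOn_of_compact hK,
    tendstoLocallyUniformlyOn_iff_filter]
  intro m hm
  obtain ⟨a, hF, hf⟩ := h m hm
  rw [tendstoUniformlyOnFilter_iff_tendsto]
  refine Tendsto.mono_left ?_ (Filter.prod_mono_right l nhdsWithin_le_nhds)
  refine Tendsto.mono_right ?_ (nhds_le_uniformity a)
  rw [nhds_prod_eq]
  exact (hf.comp tendsto_snd).prodMk hF

/-- The determinant of the test vectors cancels in the quotient, leaving g(h, p) / g(0, p). This is
why the bases `v m` may depend on the point without any continuity. -/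
theorem tendstoUniformlyOn_quotient (hX : ∀ i m, SmoothAt (X i) m)
    (htop : ∀ i, r ≤ i → ∀ m, flagAt X i m = ⊤) {Q : ℤ}
    (hQ : ∀ m ∈ equiregularRegion X r, homDim X r m = Q) {K : Set M}
    (hKX : K ⊆ equiregularRegion X r) (hK : IsCompact K)
    (v : (m : M) → Module.Basis (Fin d) ℝ (TangentSpace (𝓡 d) m)) :
    TendstoUniformlyOn (fun (h : ℝ) m => h ^ (Q - d) * approxVol X r h m (v m)
      / poppVol X r m (v m)) (fun _ => 1) (𝓝[>] 0) K := by
  refine tendstoUniformlyOn_of_tendsto_prod hK fun m hm => ⟨1, ?_, tendsto_const_nhds⟩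
  obtain ⟨O, Y, hY, g, hO, hmO, hg, hgpos, hvol, hpopp⟩ :=
    exists_local_formula hX htop hQ (hKX hm)
  have h0 : Tendsto (fun q : ℝ × M => g q / g (0, q.2)) (𝓝[>] 0 ×ˢ 𝓝 m) (𝓝 1) := by
    have hle : 𝓝[>] (0 : ℝ) ×ˢ 𝓝 m ≤ 𝓝 (0, m) := by
      rw [nhds_prod_eq]; exact Filter.prod_mono_left _ nhdsWithin_le_nhds
    have h2 : Tendsto (fun q : ℝ × M => g (0, q.2)) (𝓝 (0, m)) (𝓝 (g (0, m))) := by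
      refine Tendsto.comp (y := 𝓝 (0, m)) hg ?_
      exact (continuous_const.prodMk continuous_snd).tendsto' _ _ rfl
    have := (hg.tendsto.div h2 (hgpos 0 m hmO).ne').mono_left hle
    rwa [div_self (hgpos 0 m hmO).ne'] at this
  refine h0.congr' ?_
  filter_upwards [prod_mem_prod self_mem_nhdsWithin (hO.mem_nhds hmO)] with q hq
  rw [hvol q.1 hq.1 q.2 hq.2, hpopp q.2 hq.2,
    mul_div_mul_left _ _ (abs_pos.2 (frameDet_ne_zero hY hq.2 _)).ne']

theorem tendstoUniformlyOn_frame (hX : ∀ i m, SmoothAt (X i) m)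
    (htop : ∀ i, r ≤ i → ∀ m, flagAt X i m = ⊤) {Q : ℤ}
    (hQ : ∀ m ∈ equiregularRegion X r, homDim X r m = Q) {U : Set M} {V : Fin d → VField d M}
    (hU : IsOpen U) (hV : IsLocalFrameOn (𝓡 d) (EuclideanSpace ℝ (Fin d)) ∞ V U) {K : Set M}
    (hKX : K ⊆ U ∩ equiregularRegion X r) (hK : IsCompact K) :
    TendstoUniformlyOn (fun (h : ℝ) m => h ^ (Q - d) * approxVol X r h m (fun k => V k m))
      (fun m => poppVol X r m (fun k => V k m)) (𝓝[>] 0) K := by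
  refine tendstoUniformlyOn_of_tendsto_prod hK fun m hm => ?_
  obtain ⟨O, Y, hY, g, hO, hmO, hg, hgpos, hvol, hpopp⟩ :=
    exists_local_formula hX htop hQ (hKX hm).2
  have hdet : ContinuousAt (fun p => |frameDet hY p fun k => V k p|) m :=
    (contMDiffAt_det fun i j =>
      contMDiffAt_coeff hO hY hmO (hV.contMDiffAt hU (hKX hm).1 j) i).continuousAt.abs
  have hprod : ContinuousAt (fun q : ℝ × M => |frameDet hY q.2 fun k => V k q.2| * g q) (0, m) :=
    ContinuousAt.mul (ContinuousAt.comp (f := Prod.snd) (x := ((0 : ℝ), m))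
      (g := fun p => |frameDet hY p fun k => V k p|) hdet continuousAt_snd) hg
  refine ⟨_, (hprod.tendsto.mono_left ?_).congr' ?_,
    Tendsto.congr' ?_ (Tendsto.comp (f := fun p => ((0 : ℝ), p)) hprod ?_)⟩
  · rw [nhds_prod_eq]; exact Filter.prod_mono_left _ nhdsWithin_le_nhds
  · filter_upwards [prod_mem_prod self_mem_nhdsWithin (hO.mem_nhds hmO)] with q hq
    rw [hvol q.1 hq.1 q.2 hq.2]
  · filter_upwards [hO.mem_nhds hmO] with p hp
    rw [hpopp p hp]
    rfl
  · exact (continuous_const.prodMk continuous_id).tendsto' _ _ rfl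

/-- The rescaled ratio is (dvol_{g^1} / (h^{Q-d} dvol_{g^h}))², so f is the square of dvol_{g^1} /
𝒫. Dividing dvol_{g^1} by √f returns 𝒫 on every frame, since all densities at a point are
proportional. -/
theorem inducedVol_eq (hX : ∀ i m, SmoothAt (X i) m)
    (htop : ∀ i, r ≤ i → ∀ m, flagAt X i m = ⊤) {Q : ℤ}
    (hQ : ∀ m ∈ equiregularRegion X r, homDim X r m = Q) (hm : m ∈ equiregularRegion X r) :
    Tendsto (fun h : ℝ => h ^ (2 * ((d : ℤ) - Q)) * volRatioSq X r h m) (𝓝[>] 0)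
        (𝓝 (limRatio X r Q m)) ∧
      0 < limRatio X r Q m ∧ inducedVol X r Q m = poppVol X r m := by
  obtain ⟨O, Y, hY, g, hO, hmO, hg, hgpos, hvol, hpopp⟩ := exists_local_formula hX htop hQ hm
  have hD : 0 < |frameDet hY m (refBasis m)| := by
    let b : Module.Basis (Fin d) ℝ (TangentSpace (𝓡 d) m) :=
      (EuclideanSpace.basisFun (Fin d) ℝ).toBasis
    have : refBasis m = b := funext fun i => by
      simp only [b, refBasis]
      exact ((congrFun (EuclideanSpace.basisFun (Fin d) ℝ).coe_toBasis i).trans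
        (EuclideanSpace.basisFun_apply _ _ i)).symm
    rw [this]
    exact abs_pos.2 (frameDet_ne_zero hY hmO b)
  have hvol1 : ∀ v, approxVol X r 1 m v = |frameDet hY m v| * g (1, m) := fun v => by
    simpa using hvol 1 one_pos m hmO v
  have hP := hpopp m hmO (refBasis m)
  have hPpos : 0 < poppVol X r m (refBasis m) := by
    rw [hP]; exact mul_pos hD (hgpos 0 m hmO)
  have h1pos : 0 < approxVol X r 1 m (refBasis m) := by
    rw [hvol1]; exact mul_pos hD (hgpos 1 m hmO)
  have hlim : Tendsto (fun h : ℝ => h ^ (2 * ((d : ℤ) - Q)) * volRatioSq X r h m) (𝓝[>] 0)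
      (𝓝 ((approxVol X r 1 m (refBasis m) / poppVol X r m (refBasis m)) ^ 2)) := by
    have h := tendsto_poppVol hX htop hm (refBasis m)
    rw [hQ m hm] at h
    refine ((tendsto_const_nhds.div h hPpos.ne').pow 2).congr' ?_
    -- The rearrangement holds for every real h, as inversion is multiplicative even at 0.
    filter_upwards with h
    have hpow : h ^ (2 * ((d : ℤ) - Q)) = ((h ^ (Q - d))⁻¹) ^ 2 := by
      rw [mul_comm, zpow_mul, show (d : ℤ) - Q = -(Q - d) by ring, zpow_neg]
      rfl
    rw [volRatioSq, hpow, Pi.div_apply]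
    ring
  have hr : limRatio X r Q m =
      (approxVol X r 1 m (refBasis m) / poppVol X r m (refBasis m)) ^ 2 := hlim.limUnder_eq
  rw [hr]
  refine ⟨hlim, by positivity, funext fun v => ?_⟩
  have h0 := hgpos 0 m hmO
  have h1 := hgpos 1 m hmO
  rw [inducedVol, hr, Real.sqrt_sq (by positivity), hvol1, hvol1, hpopp m hmO v, hP]
  field_simp

end UniformLimit

end SubRiem

theorem theorem1 {d : ℕ} {M : Type*} [TopologicalSpace M] [T2Space M]
    [SecondCountableTopology M] [ConnectedSpace M]
    [ChartedSpace (EuclideanSpace ℝ (Fin d)) M] [IsManifold (𝓡 d) ∞ M]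
    {N₀ : ℕ} (X : Fin N₀ → SubRiem.VField d M)
    (hX : ∀ i, ContMDiff (𝓡 d) (𝓡 d).tangent ∞
      (fun m => (⟨m, X i m⟩ : TangentBundle (𝓡 d) M)))
    (hH : SubRiem.Hormander X)
    (r : ℕ) (hr : IsGreatest (Set.range (SubRiem.stepAt X)) r)
    (Q : ℤ) (hQ : ∀ m ∈ SubRiem.equiregularRegion X r, SubRiem.homDim X r m = Q) :
    -- Popp's volume is well defined: adapted frames exist, and all give the same density
    (∀ m ∈ SubRiem.equiregularRegion X r,
      Nonempty (SubRiem.AdaptedFrame X r m) ∧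
      ∀ F : SubRiem.AdaptedFrame X r m, SubRiem.poppVol X r m = F.poppFormula) ∧
    -- the quotient of the rescaled volumes by Popp's volume tends to one, uniformly on compacts
    (∀ K ⊆ SubRiem.equiregularRegion X r, IsCompact K →
      ∀ v : (m : M) → Module.Basis (Fin d) ℝ (TangentSpace (𝓡 d) m),
        TendstoUniformlyOn
          (fun (h : ℝ) m => h ^ (Q - d) * SubRiem.approxVol X r h m (v m)
            / SubRiem.poppVol X r m (v m))
          (fun _ => 1) (𝓝[>] 0) K) ∧
    -- in every smooth local frame, the coefficients converge, uniformly on compacts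
    (∀ (U : Set M) (V : Fin d → SubRiem.VField d M), IsOpen U →
      IsLocalFrameOn (𝓡 d) (EuclideanSpace ℝ (Fin d)) ∞ V U →
      ∀ K ⊆ U ∩ SubRiem.equiregularRegion X r, IsCompact K →
        TendstoUniformlyOn
          (fun (h : ℝ) m => h ^ (Q - d) * SubRiem.approxVol X r h m (fun k => V k m))
          (fun m => SubRiem.poppVol X r m (fun k => V k m)) (𝓝[>] 0) K) ∧
    -- the volume induced by the approximation scheme exists and equals Popp's volume
    (∀ m ∈ SubRiem.equiregularRegion X r,
      Tendsto (fun h : ℝ => h ^ (2 * ((d : ℤ) - Q)) * SubRiem.volRatioSq X r h m) (𝓝[>] 0)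
        (𝓝 (SubRiem.limRatio X r Q m)) ∧
      0 < SubRiem.limRatio X r Q m ∧
      SubRiem.inducedVol X r Q m = SubRiem.poppVol X r m) := by
  have hXs : ∀ i m, SubRiem.SmoothAt (X i) m := fun i m => hX i m
  have htop : ∀ i, r ≤ i → ∀ m, SubRiem.flagAt X i m = ⊤ :=
    fun _ hi m => SubRiem.flagAt_eq_top hH hr hi m
  exact ⟨fun m hm => ⟨SubRiem.nonempty_adaptedFrame hXs htop hm,
      SubRiem.poppVol_eq hXs htop hm⟩,
    fun K hK hKc v => SubRiem.tendstoUniformlyOn_quotient hXs htop hQ hK hKc v,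
    fun U V hU hV K hK hKc => SubRiem.tendstoUniformlyOn_frame hXs htop hQ hU hV hK hKc,
    fun m hm => SubRiem.inducedVol_eq hXs htop hQ hm⟩
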